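/- **Slow entropy.** Let $T$ be an action of $\mathbb Z^k$ on a probability space $(X,\mu)$ by measure-preserving maps. For a finite measurable partition $\xi$ of $X$ and a finite non-empty set $F\subset\mathbb Z^k$ let $d^H_{F}(x,y)$ be the proportion of those $t\in F$ for which $T_tx$ and $T_ty$ lie in different elements of $\xi$, and let $S^H_\xi(T,F,\varepsilon,\delta)$ be the minimal number of $d^H_F$-balls of radius $\varepsilon$ whose union has measure at least $1-\delta$. For a norm $p$ on $\mathbb R^k$ put $F^p_s=\{t\in\mathbb Z^k: p(t)\le s\}$, $$sh(p,T)=\sup_\xi\ \lim_{\varepsilon,\delta\to0}\ \limsup_{s\to\infty}\ \frac1s\log S^H_\xi(T,F^p_s,\varepsilon,\delta),\qquad sh(T)=\inf_{p}\, sh(p,T),$$ where the supremum is over all finite measurable partitions and the infimum is over all norms $p$ on $\mathbb R^k$ whose unit ball has Lebesgue measure $1$. **Cartan actions.** Let $n\ge2$. A Cartan action on $\mathbb T^n=\mathbb R^n/\mathbb Z^n$ (with Lebesgue measure) is an action $\alpha$ of $\mathbb Z^{n-1}$ by affine automorphisms $x\mapsto A(t)x+b(t)$, $A(t)\in GL(n,\mathbb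 Z)$ (for example by automorphisms, $b=0$), such that for every $t\ne0$ the matrix $A(t)$ is hyperbolic, i.e. has no complex eigenvalue of absolute value $1$. A number field $K$ together with a homomorphism $\gamma:\mathbb Z^{n-1}\to U_K$ into the group $U_K$ of units of its ring of integers is associated with $\alpha$ if there is a non-zero $v\in K^n$ with $A(t)v=\gamma(t)v$ for all $t$, and $K$ is generated over $\mathbb Q$ by the $\gamma(t)$. **Theorem.** There are constants $C(n)$, $n\ge2$, depending only on $n$, with $$\frac{n-1}{2}\le C(n)\le n-1,$$ such that for every $n\ge 2$ and every Cartan action $\alpha$ on $\mathbb T^n$ the following holds. There is a number field $K$ with a homomorphism $\gamma$ associated with $\alpha$; and for every such $K$ and $\gamma$, the field $K$ is totally real, the index $k=[U_K:\{\pm1\}\cdot\gamma(\mathbb Z^{n-1})]$ is finite, and $$sh(\alpha)=C(n)\,R^{\frac1{n-1}},\qquad R=k\,R_K,$$ where $R_K$ is the regulator of $K$. -/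

import Mathlib

open MeasureTheory Filter

noncomputable section

namespace SlowEntropy

/-! ### Slow entropy of a measure-preserving action of `ℤ^k` -/

section General

variable {X : Type*} {k : ℕ}

/-- The pull-back to `X` of the normalized Hamming metric on `F`-codes with respect to the finite
partition `ξ` (a partition into `N` labelled pieces is the function sending a point to the label
of its piece): the proportion of `t ∈ F` for which `T t x` and `T t y` lie in different pieces. -/
def hamming (T : (Fin k → ℤ) → X → X) {N : ℕ} (ξ : X → Fin N) (F : Set (Fin k → ℤ))
    (x y : X) : ℝ :=
  ({t ∈ F | ξ (T t x) ≠ ξ (T t y)}.ncard : ℝ) / (F.ncard : ℝ)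

/-- The minimal number of Hamming balls of radius `ε` whose union has measure at least `1 - δ`. -/
def coverNumber [MeasurableSpace X] (μ : Measure X) (T : (Fin k → ℤ) → X → X) {N : ℕ}
    (ξ : X → Fin N) (F : Set (Fin k → ℤ)) (ε δ : ℝ) : ℕ :=
  sInf {m : ℕ | ∃ E : Finset X, E.card = m ∧
    ENNReal.ofReal (1 - δ) ≤ μ (⋃ x ∈ E, {y | hamming T ξ F x y < ε})}

/-- `p` is a norm on `ℝ^k`. -/
def IsNorm (p : Seminorm ℝ (Fin k → ℝ)) : Prop := ∀ x, p x = 0 → x = 0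

/-- The integer points of the closed ball of radius `s` centred at `0` for `p`. -/
def latticeBall (p : Seminorm ℝ (Fin k → ℝ)) (s : ℝ) : Set (Fin k → ℤ) :=
  {t | p (fun i => (t i : ℝ)) ≤ s}

/-- The slow entropy with respect to the norm `p` and the partition `ξ`. The cover number does not
increase when `ε` or `δ` increases, so the limit as `ε, δ → 0` is the supremum over positive `ε`
and `δ`. -/
def slowEntropyPartition [MeasurableSpace X] (μ : Measure X) (T : (Fin k → ℤ) → X → X)
    (p : Seminorm ℝ (Fin k → ℝ)) {N : ℕ} (ξ : X → Fin N) : EReal :=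
  ⨆ (ε : ℝ) (_ : 0 < ε) (δ : ℝ) (_ : 0 < δ),
    limsup (fun s : ℝ =>
      ((Real.log (coverNumber μ T ξ (latticeBall p s) ε δ) / s : ℝ) : EReal)) atTop

/-- The slow entropy with respect to the norm `p`: the supremum over all finite measurable
partitions. -/
def slowEntropyNorm [MeasurableSpace X] (μ : Measure X) (T : (Fin k → ℤ) → X → X)
    (p : Seminorm ℝ (Fin k → ℝ)) : EReal :=
  ⨆ (N : ℕ) (ξ : X → Fin N) (_ : Measurable ξ), slowEntropyPartition μ T p ξ

/-- The slow entropy: the infimum over all norms whose unit ball has Lebesgue measure one. -/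
def slowEntropy [MeasurableSpace X] (μ : Measure X) (T : (Fin k → ℤ) → X → X) : EReal :=
  ⨅ (p : Seminorm ℝ (Fin k → ℝ)) (_ : IsNorm p) (_ : volume {x | p x ≤ 1} = 1),
    slowEntropyNorm μ T p

end General

/-! ### Cartan actions -/

/-- The torus `ℝ^n / ℤ^n`; its `volume` is the normalized Lebesgue (Haar) measure. -/
abbrev Torus (n : ℕ) : Type := Fin n → UnitAddCircle

/-- The endomorphism of the torus given by an integer matrix. -/
def torusEnd {n : ℕ} (M : Matrix (Fin n) (Fin n) ℤ) (x : Torus n) : Torus n :=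
  fun i => ∑ j, M i j • x j

/-- An action of `ℤ^k` on the torus by the affine maps `x ↦ A(t) x + b(t)`, with `A(t)` in
`GL(n, ℤ)`. An action by automorphisms is one with `b = 0`. -/
structure AffineAction (k n : ℕ) where
  /-- the linear parts -/
  linear : Multiplicative (Fin k → ℤ) →* GL (Fin n) ℤ
  /-- the translation parts -/
  translation : (Fin k → ℤ) → Torus n
  translation_add : ∀ s t, translation (s + t) =
    torusEnd (linear (Multiplicative.ofAdd s)).val (translation t) + translation s

/-- The integer matrix of the linear part of the element `t`. -/
def AffineAction.mat {k n : ℕ} (α : AffineAction k n) (t : Fin k → ℤ) :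
    Matrix (Fin n) (Fin n) ℤ :=
  (α.linear (Multiplicative.ofAdd t)).val

/-- The transformation of the torus by which the element `t` acts. -/
def AffineAction.act {k n : ℕ} (α : AffineAction k n) (t : Fin k → ℤ) (x : Torus n) : Torus n :=
  torusEnd (α.mat t) x + α.translation t

/-- An integer matrix is hyperbolic if it has no complex eigenvalue of absolute value one. -/
def IsHyperbolic {n : ℕ} (M : Matrix (Fin n) (Fin n) ℤ) : Prop :=
  ∀ z : ℂ, (M.map (Int.cast : ℤ → ℂ)).charpoly.IsRoot z → ‖z‖ ≠ 1

/-- A Cartan action: an action of `ℤ^(n-1)` on the `n`-torus all of whose elements other than the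
identity are hyperbolic. -/
def IsCartan {n : ℕ} (α : AffineAction (n - 1) n) : Prop :=
  ∀ t, t ≠ 0 → IsHyperbolic (α.mat t)

/-- `K` is the number field associated with the action and `γ` is the map sending the elements of
the action to units of `K`: the linear parts have a common eigenvector over `K`, the eigenvalue of
the element `t` is `γ t`, and these eigenvalues generate `K` over `ℚ`. -/
structure IsAssociatedField {k n : ℕ} (α : AffineAction k n) (K : Type*) [Field K] [NumberField K]
    (γ : Multiplicative (Fin k → ℤ) →* (NumberField.RingOfIntegers K)ˣ) : Prop where
  exists_eigenvector : ∃ v : Fin n → K, v ≠ 0 ∧ ∀ t : Fin k → ℤ,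
    ((α.mat t).map (Int.cast : ℤ → K)).mulVec v =
      (((γ (Multiplicative.ofAdd t)).val : NumberField.RingOfIntegers K) : K) • v
  generates : IntermediateField.adjoin ℚ (Set.range fun t : Fin k → ℤ =>
      (((γ (Multiplicative.ofAdd t)).val : NumberField.RingOfIntegers K) : K)) = ⊤

/-- The group of units of `K` coming from the action, taken together with the roots of unity
`±1` of `K`. -/
def unitGroup {k : ℕ} {K : Type*} [Field K] [NumberField K]
    (γ : Multiplicative (Fin k → ℤ) →* (NumberField.RingOfIntegers K)ˣ) :
    Subgroup (NumberField.RingOfIntegers K)ˣ :=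
  γ.range ⊔ NumberField.Units.torsion K

end SlowEntropy

end

namespace SlowEntropy

/-! ### The number field of a Cartan action -/

/-! Arithmetic. The linear parts have a common eigenvector over the associated field $K$. Its images
under distinct embeddings are independent, because a rational matrix realizing a primitive element
separates them; hence $[K:\mathbb Q]\le n$. Hyperbolicity makes $t\mapsto\log|\gamma(t)|$ injective
with image in the unit lattice, so the unit rank $r_1+r_2-1$ is at least $n-1$. With $r_1+2r_2\le n$
this forces $K$ to be totally real and the index to be finite. The conjugates form an eigenbasis;
$n-1$ of the Lyapunov exponents $\chi_i$ are the coordinates composed with a matrix of determinant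
$\pm kR_K$, and the last one is minus their sum.

Dynamics. For every norm $p$ the slow entropy is $\sum_i\|\chi_i\|_p^*$
(`IsDiagonalization.slowEntropyNorm_eq`). For the upper bound, eigencoordinates are rounded at scale
$e^{-s\|\chi_i\|_p^*}$, which keeps orbits close over the whole ball $F^p_s$. For the lower bound,
the orbit of the difference of two Hamming-close points is mostly near $0$. For each $i$ one follows
it along multiples of an element $\tau_i$ nearly maximizing $\chi_i$; expansion codes the $i$-th
coordinate by a sparse integer sequence, so it lies in few intervals of length about
$e^{-J\chi_i(\tau_i)}$. Each coordinate having its own $\tau_i$, the product of these lengths shows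
that Hamming balls have measure at most about $e^{-s\sum_i\|\chi_i\|_p^*}$.

Minimization. Rescaling the matrix of exponents to determinant $\pm1$ permutes the normalized norms
and extracts the factor $R^{1/(n-1)}$ (`iInf_sum_dualNorm`). What remains depends on $n$ only, and
is estimated by boxing the unit ball from below and by testing the cube from above. -/

theorem exists_common_eigenvector {F ι V : Type*} [Field F] [IsAlgClosed F] [AddCommGroup V]
    [Module F V] [FiniteDimensional F V] [Nontrivial V] (f : ι → Module.End F V)
    (hf : ∀ i j, Commute (f i) (f j)) :
    ∃ v : V, v ≠ 0 ∧ ∃ c : ι → F, ∀ i, f i v = c i • v := by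
  -- In a minimal non-zero invariant subspace, the part belonging to an eigenvalue of one operator
  -- is invariant under all of them by commutation, hence is everything. So all operators act on it
  -- by scalars.
  obtain ⟨W, ⟨hW0, hWf⟩, hmin⟩ := wellFounded_lt.has_min
    {W : Submodule F V | W ≠ ⊥ ∧ ∀ i, ∀ w ∈ W, f i w ∈ W} ⟨⊤, top_ne_bot, by simp⟩
  have hscal : ∀ i, ∃ c : F, ∀ w ∈ W, f i w = c • w := by
    intro i
    have : Nontrivial W := Submodule.nontrivial_iff_ne_bot.2 hW0
    obtain ⟨c, hc⟩ := Module.End.exists_eigenvalue ((f i).restrict (hWf i))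
    obtain ⟨w, hw⟩ := hc.exists_hasEigenvector
    have hw1 : f i w = c • (w : V) := congrArg Subtype.val hw.apply_eq_smul
    have hW' : W ⊓ Module.End.eigenspace (f i) c = W := by
      by_contra hne
      refine hmin _ ⟨?_, ?_⟩ (lt_of_le_of_ne inf_le_left hne)
      · rw [Submodule.ne_bot_iff]
        exact ⟨w, ⟨w.2, Module.End.mem_eigenspace_iff.2 hw1⟩, fun h => hw.2 (Subtype.ext h)⟩
      · rintro j x ⟨hx, hx'⟩
        refine ⟨hWf j x hx, ?_⟩
        rw [SetLike.mem_coe, Module.End.mem_eigenspace_iff] at hx'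
        rw [SetLike.mem_coe, Module.End.mem_eigenspace_iff]
        have := congrArg (fun g : Module.End F V => g x) (hf i j).eq
        simp only [Module.End.mul_apply] at this
        rw [this, hx', map_smul]
    exact ⟨c, fun x hx => Module.End.mem_eigenspace_iff.1 (hW'.ge hx).2⟩
  choose c hc using hscal
  obtain ⟨v, hv, hv0⟩ := (Submodule.ne_bot_iff _).1 hW0
  exact ⟨v, hv0, c, fun i => hc i v hv⟩

theorem AffineAction.mat_add {k n : ℕ} (α : AffineAction k n) (s t : Fin k → ℤ) :
    α.mat (s + t) = α.mat s * α.mat t := by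
  simp [AffineAction.mat, ofAdd_add]

theorem AffineAction.mat_zero {k n : ℕ} (α : AffineAction k n) : α.mat 0 = 1 := by
  simp [AffineAction.mat]

theorem ofAdd_eq_prod {k : ℕ} (t : Fin k → ℤ) :
    Multiplicative.ofAdd t =
      ∏ i, (Multiplicative.ofAdd (Pi.single i (1 : ℤ) : Fin k → ℤ)) ^ (t i) := by
  have h : t = ∑ i, t i • (Pi.single i (1 : ℤ) : Fin k → ℤ) := by
    ext j
    simp [Finset.sum_apply, Pi.single_apply]
  conv_lhs => rw [h]
  rw [ofAdd_sum]
  exact Finset.prod_congr rfl fun i _ => ofAdd_zsmul _ _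

/-- Every action by affine automorphisms has an associated number field. -/
theorem exists_isAssociatedField {k n : ℕ} (hn : 0 < n) (α : AffineAction k n) :
    ∃ (K : Type) (_ : Field K) (_ : NumberField K)
      (γ : Multiplicative (Fin k → ℤ) →* (NumberField.RingOfIntegers K)ˣ),
      IsAssociatedField α K γ := by
  classical
  have : Nonempty (Fin n) := ⟨⟨0, hn⟩⟩
  let B : (Fin k → ℤ) → Matrix (Fin n) (Fin n) ℂ := fun t => (α.mat t).map (Int.cast : ℤ → ℂ)
  have hB : ∀ s t, B (s + t) = B s * B t := fun s t => by
    simp only [B, α.mat_add]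
    exact Matrix.map_mul (f := Int.castRingHom ℂ)
  have hB0 : B 0 = 1 := by simp [B, α.mat_zero]
  obtain ⟨v, hv0, c, hc⟩ := exists_common_eigenvector (fun t => Matrix.toLin' (B t)) (by
    intro s t
    change Matrix.toLin' (B s) * Matrix.toLin' (B t) = Matrix.toLin' (B t) * Matrix.toLin' (B s)
    rw [Module.End.mul_eq_comp, Module.End.mul_eq_comp, ← Matrix.toLin'_mul, ← Matrix.toLin'_mul,
      ← hB, ← hB, add_comm])
  simp only [Matrix.toLin'_apply] at hc
  have hinj : ∀ a b : ℂ, a • v = b • v → a = b := fun a b h => smul_left_injective ℂ hv0 h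
  let χ : Multiplicative (Fin k → ℤ) →* ℂ :=
    { toFun := fun t => c t.toAdd
      map_one' := hinj _ _ (by rw [← hc]; simp [hB0])
      map_mul' := fun s t => hinj _ _ (by
        rw [← hc, toAdd_mul, hB, ← Matrix.mulVec_mulVec, hc, Matrix.mulVec_smul, hc, smul_smul,
          mul_comm]) }
  have hint : ∀ t, IsIntegral ℤ (χ t) := by
    intro t
    refine ⟨(α.mat t.toAdd).charpoly, Matrix.charpoly_monic _, ?_⟩
    rw [← Polynomial.eval_map, ← Matrix.charpoly_map]
    have : Module.End.HasEigenvalue (Matrix.toLin' (B t.toAdd)) (χ t) :=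
      Module.End.hasEigenvalue_of_hasEigenvector (x := v)
        ⟨Module.End.mem_eigenspace_iff.2 (by rw [Matrix.toLin'_apply, hc]; rfl), hv0⟩
    rw [Module.End.hasEigenvalue_iff_isRoot_charpoly, Matrix.charpoly_toLin'] at this
    exact this
  -- Generators of $\mathbb Z^k$ suffice, and a finite generating set makes the extension finite;
  -- the other eigenvalues are products of integral powers of these.
  let S : Set ℂ := Set.range fun i : Fin k => χ (Multiplicative.ofAdd (Pi.single i 1))
  let K := IntermediateField.adjoin ℚ S
  have : Finite S := Set.finite_range _
  have : FiniteDimensional ℚ K := IntermediateField.finiteDimensional_adjoin (by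
    rintro _ ⟨i, rfl⟩
    exact (hint _).tower_top)
  have : NumberField K := ⟨⟩
  have hmem : ∀ t, χ t ∈ K := by
    intro t
    change χ (Multiplicative.ofAdd t.toAdd) ∈ K
    rw [ofAdd_eq_prod, map_prod]
    refine prod_mem fun i _ => ?_
    have : χ (Multiplicative.ofAdd (Pi.single i (1 : ℤ)) ^ (t.toAdd i)) =
        χ (Multiplicative.ofAdd (Pi.single i (1 : ℤ))) ^ (t.toAdd i) := by
      have := map_zpow (χ.toHomUnits) (Multiplicative.ofAdd (Pi.single i (1 : ℤ))) (t.toAdd i)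
      have := congrArg Units.val this
      simpa only [Units.val_zpow_eq_zpow_val, MonoidHom.coe_toHomUnits] using this
    rw [this]
    exact zpow_mem (IntermediateField.subset_adjoin ℚ S ⟨i, rfl⟩) _
  have hintK : ∀ t, IsIntegral ℤ (⟨χ t, hmem t⟩ : K) := fun t =>
    (isIntegral_algHom_iff (K.val.restrictScalars ℤ) Subtype.val_injective).1 (hint t)
  let γ₀ : Multiplicative (Fin k → ℤ) →* NumberField.RingOfIntegers K :=
    { toFun := fun t => ⟨⟨χ t, hmem t⟩, hintK t⟩
      map_one' := by
        ext
        exact map_one χ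
      map_mul' := fun s t => by
        ext
        exact map_mul χ s t }
  have hγ : ∀ t, (((γ₀.toHomUnits t).val : NumberField.RingOfIntegers K) : K) = ⟨χ t, hmem t⟩ :=
    fun t => rfl
  refine ⟨K, inferInstance, inferInstance, γ₀.toHomUnits, ⟨?_, ?_⟩⟩
  · obtain ⟨i, hi⟩ := Function.ne_iff.1 hv0
    -- The complex eigenvector is brought into $K^n$ by applying a $K$-linear functional $\mathbb
    -- C\to K$ to its coordinates: this commutes with integer matrices and with the eigenvalues,
    -- which lie in $K$.
    obtain ⟨φ, hφ⟩ : ∃ φ : Module.Dual K ℂ, φ (v i) ≠ 0 := by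
      by_contra! h
      exact hi ((Module.forall_dual_apply_eq_zero_iff K (v i)).1 h)
    refine ⟨fun j => φ (v j), fun h => hφ (congrFun h i), fun t => ?_⟩
    rw [hγ]
    ext1 j
    have h1 := congrArg φ (congrFun (hc t) j)
    have h2 : c t • v = (⟨χ (Multiplicative.ofAdd t), hmem _⟩ : K) • v := rfl
    rw [h2, Pi.smul_apply, map_smul] at h1
    rw [Pi.smul_apply, ← h1]
    simp only [Matrix.mulVec, dotProduct, B, Matrix.map_apply, map_sum]
    refine Finset.sum_congr rfl fun l _ => ?_
    rw [← zsmul_eq_mul, ← zsmul_eq_mul, map_zsmul]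
  · rw [eq_top_iff]
    have h1 : IntermediateField.map K.val (IntermediateField.adjoin ℚ
        (Set.range fun t : Fin k → ℤ => (⟨χ (Multiplicative.ofAdd t), hmem _⟩ : K))) = K := by
      rw [IntermediateField.adjoin_map, ← Set.range_comp]
      apply le_antisymm
      · rw [IntermediateField.adjoin_le_iff]
        rintro _ ⟨t, rfl⟩
        exact hmem _
      · refine IntermediateField.adjoin.mono _ _ _ ?_
        rintro _ ⟨i, rfl⟩
        exact ⟨Pi.single i 1, rfl⟩
    intro x _
    have hx : (x : ℂ) ∈ IntermediateField.map K.val (IntermediateField.adjoin ℚ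
        (Set.range fun t : Fin k → ℤ => (⟨χ (Multiplicative.ofAdd t), hmem _⟩ : K))) := by
      rw [h1]; exact x.2
    obtain ⟨y, hy, hyx⟩ := hx
    have : y = x := Subtype.ext hyx
    rw [← this]
    exact hy

/-! ### Conjugate eigenvectors, the degree of the field, and torsion -/

section AssociatedField

variable {k n : ℕ} {α : AffineAction k n} {K : Type*} [Field K] [NumberField K]
  {γ : Multiplicative (Fin k → ℤ) →* (NumberField.RingOfIntegers K)ˣ}

/-- Multiplication by any element of the associated field is realized on the eigenvector by a
rational matrix. -/
theorem IsAssociatedField.exists_matrix (h : IsAssociatedField α K γ) {v : Fin n → K}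
    (hv : ∀ t : Fin k → ℤ, ((α.mat t).map (Int.cast : ℤ → K)).mulVec v =
      (((γ (Multiplicative.ofAdd t)).val : NumberField.RingOfIntegers K) : K) • v) (θ : K) :
    ∃ M : Matrix (Fin n) (Fin n) ℚ, (M.map (algebraMap ℚ K)).mulVec v = θ • v := by
  have hθ : θ ∈ Algebra.adjoin ℚ (Set.range fun t : Fin k → ℤ =>
      (((γ (Multiplicative.ofAdd t)).val : NumberField.RingOfIntegers K) : K)) := by
    rw [← IntermediateField.adjoin_toSubalgebra_of_isAlgebraic (fun x _ =>
      Algebra.IsAlgebraic.isAlgebraic x), h.generates]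
    trivial
  induction hθ using Algebra.adjoin_induction with
  | mem x hx =>
    obtain ⟨t, rfl⟩ := hx
    refine ⟨(α.mat t).map Int.cast, ?_⟩
    rw [← hv t]
    congr 1
    ext i j
    simp
  | algebraMap r =>
    refine ⟨Matrix.diagonal fun _ => r, ?_⟩
    ext i
    simp [Matrix.diagonal_map, Matrix.mulVec_diagonal]
  | add x y _ _ hx hy =>
    obtain ⟨M, hM⟩ := hx
    obtain ⟨N, hN⟩ := hy
    refine ⟨M + N, ?_⟩
    rw [Matrix.map_add _ (by simp), Matrix.add_mulVec, hM, hN, add_smul]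
  | mul x y _ _ hx hy =>
    obtain ⟨M, hM⟩ := hx
    obtain ⟨N, hN⟩ := hy
    refine ⟨M * N, ?_⟩
    rw [Matrix.map_mul, ← Matrix.mulVec_mulVec, hN, Matrix.mulVec_smul, hM, smul_smul, mul_comm]

theorem map_mulVec {R S : Type*} [CommRing R] [CommRing S] (σ : R →+* S) {m : Type*} [Fintype m]
    (M : Matrix m m R) (v : m → R) : (M.map σ).mulVec (σ ∘ v) = σ ∘ M.mulVec v :=
  (RingHom.map_mulVec σ M v |> fun h => funext h).symm

/-- The conjugates of the eigenvector are linearly independent. -/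
theorem IsAssociatedField.linearIndependent (h : IsAssociatedField α K γ) {v : Fin n → K}
    (hv0 : v ≠ 0) (hv : ∀ t : Fin k → ℤ, ((α.mat t).map (Int.cast : ℤ → K)).mulVec v =
      (((γ (Multiplicative.ofAdd t)).val : NumberField.RingOfIntegers K) : K) • v)
    {F : Type*} [Field F] [CharZero F] :
    LinearIndependent F (fun σ : K →+* F => (σ ∘ v : Fin n → F)) := by
  -- The conjugates of `v` are eigenvectors of a single rational matrix, with eigenvalues `σ θ`;
  -- these are distinct because `θ` is primitive.
  obtain ⟨θ, hθ⟩ := Field.exists_primitive_element ℚ K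
  obtain ⟨M, hM⟩ := h.exists_matrix hv θ
  refine Module.End.eigenvectors_linearIndependent' (Matrix.toLin' (M.map (algebraMap ℚ F)))
    (fun σ => σ θ) ?_ _ ?_
  · intro σ τ hστ
    have : σ.toRatAlgHom = τ.toRatAlgHom :=
      AlgHom.ext_of_adjoin_eq_top (s := {θ}) (by
        rw [← IntermediateField.adjoin_toSubalgebra_of_isAlgebraic (fun x _ =>
          Algebra.IsAlgebraic.isAlgebraic x), hθ]
        rfl) (by
        rintro _ rfl
        exact hστ)
    ext x
    exact DFunLike.congr_fun this x
  · intro σ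
    refine ⟨Module.End.mem_eigenspace_iff.2 ?_, ?_⟩
    · have h1 : M.map (algebraMap ℚ F) = (M.map (algebraMap ℚ K)).map σ := by
        ext i j
        simp
      rw [Matrix.toLin'_apply, h1, map_mulVec, hM]
      ext i
      simp
    · intro h0
      apply hv0
      ext i
      have := congrFun h0 i
      simpa using this

theorem IsAssociatedField.finrank_le (h : IsAssociatedField α K γ) : Module.finrank ℚ K ≤ n := by
  obtain ⟨v, hv0, hv⟩ := h.exists_eigenvector
  have := (h.linearIndependent hv0 hv (F := ℂ)).fintype_card_le_finrank
  simpa [NumberField.Embeddings.card] using this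

/-- An embedding carries the eigenvector over $K$ to a complex one. This is how hyperbolicity
constrains the units. -/
theorem IsAssociatedField.isRoot_charpoly (h : IsAssociatedField α K γ) (σ : K →+* ℂ)
    (t : Fin k → ℤ) : ((α.mat t).map (Int.cast : ℤ → ℂ)).charpoly.IsRoot
      (σ ((γ (Multiplicative.ofAdd t)).val : NumberField.RingOfIntegers K)) := by
  obtain ⟨v, hv0, hv⟩ := h.exists_eigenvector
  rw [← Matrix.charpoly_toLin', ← Module.End.hasEigenvalue_iff_isRoot_charpoly]
  refine Module.End.hasEigenvalue_of_hasEigenvector (x := σ ∘ v)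
    ⟨Module.End.mem_eigenspace_iff.2 ?_, ?_⟩
  · have h1 : (α.mat t).map (Int.cast : ℤ → ℂ) = ((α.mat t).map (Int.cast : ℤ → K)).map σ := by
      ext i j
      simp
    rw [Matrix.toLin'_apply, h1, map_mulVec, hv]
    ext i
    exact map_mul σ _ _
  · intro h0
    apply hv0
    ext i
    have := congrFun h0 i
    simpa using this

/-- The units coming from non-trivial elements of a hyperbolic action have infinite order. -/
theorem IsAssociatedField.eq_zero_of_mem_torsion (h : IsAssociatedField α K γ)
    (hα : ∀ t, t ≠ 0 → IsHyperbolic (α.mat t)) {t : Fin k → ℤ}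
    (ht : γ (Multiplicative.ofAdd t) ∈ NumberField.Units.torsion K) : t = 0 := by
  by_contra h0
  let w : NumberField.InfinitePlace K := Classical.arbitrary _
  refine hα t h0 _ (h.isRoot_charpoly w.embedding t) ?_
  rw [NumberField.InfinitePlace.norm_embedding_eq]
  exact (NumberField.Units.mem_torsion K).1 ht w

end AssociatedField

open NumberField

/-- A family generating a discrete subgroup and independent over `ℤ` is independent over `ℝ`. -/
theorem linearIndependent_real_of_int_of_discrete {ι E : Type*} [Fintype ι]
    [NormedAddCommGroup E] [NormedSpace ℝ E] [FiniteDimensional ℝ E] {v : ι → E}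
    (hv : LinearIndependent ℤ v) (hd : DiscreteTopology (Submodule.span ℤ (Set.range v))) :
    LinearIndependent ℝ v := by
  rw [linearIndependent_iff_card_eq_finrank_span, Real.finrank_eq_int_finrank_of_discrete hd]
  exact linearIndependent_iff_card_eq_finrank_span.1 hv

/-! ### Logarithms of the units and the unit rank -/

section AssociatedField

variable {k n : ℕ} {α : AffineAction k n} {K : Type*} [Field K] [NumberField K]
  {γ : Multiplicative (Fin k → ℤ) →* (𝓞 K)ˣ}

/-- The kernel of the logarithmic embedding is torsion, which hyperbolicity excludes, so
independence holds over $\mathbb Z$. The image lies in the discrete unit lattice, which upgrades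
this to $\mathbb R$. -/
theorem IsAssociatedField.linearIndependent_logEmbedding (h : IsAssociatedField α K γ)
    (hα : ∀ t, t ≠ 0 → IsHyperbolic (α.mat t)) :
    LinearIndependent ℝ fun i : Fin k => Units.logEmbedding K
      (Additive.ofMul (γ (Multiplicative.ofAdd (Pi.single i 1)))) := by
  classical
  let Λ : (Fin k → ℤ) →+ Units.dirichletUnitTheorem.logSpace K :=
    (Units.logEmbedding K).comp (MonoidHom.toAdditiveRight γ)
  have hΛ : ∀ t, Λ t = Units.logEmbedding K (Additive.ofMul (γ (Multiplicative.ofAdd t))) :=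
    fun _ => rfl
  have hker : Λ.toIntLinearMap.ker = ⊥ := by
    rw [LinearMap.ker_eq_bot']
    intro t ht
    refine h.eq_zero_of_mem_torsion hα ?_
    rw [← Units.dirichletUnitTheorem.logEmbedding_eq_zero_iff]
    exact ht
  refine linearIndependent_real_of_int_of_discrete ?_ ?_
  · have := (Pi.basisFun ℤ (Fin k)).linearIndependent.map' Λ.toIntLinearMap hker
    have h2 : (Λ.toIntLinearMap ∘ Pi.basisFun ℤ (Fin k)) = fun i : Fin k => Units.logEmbedding K
        (Additive.ofMul (γ (Multiplicative.ofAdd (Pi.single i 1)))) := by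
      ext1 i
      simp [hΛ]
    rwa [h2] at this
  · rw [← SetLike.isDiscrete_iff_discreteTopology]
    refine (inferInstance : DiscreteTopology (Units.unitLattice K)).isDiscrete.mono ?_
    rw [SetLike.coe_subset_coe, Submodule.span_le]
    rintro _ ⟨i, rfl⟩
    exact ⟨Additive.ofMul (γ (Multiplicative.ofAdd (Pi.single i 1))), Submodule.mem_top, rfl⟩

theorem IsAssociatedField.le_rank (h : IsAssociatedField α K γ)
    (hα : ∀ t, t ≠ 0 → IsHyperbolic (α.mat t)) : k ≤ Units.rank K := by
  have := (h.linearIndependent_logEmbedding hα).fintype_card_le_finrank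
  rwa [Units.finrank_eq_rank, Fintype.card_fin] at this

end AssociatedField

theorem range_eq_closure {k : ℕ} {G : Type*} [CommGroup G]
    (γ : Multiplicative (Fin k → ℤ) →* G) :
    γ.range = Subgroup.closure (Set.range fun i => γ (Multiplicative.ofAdd (Pi.single i 1))) := by
  apply le_antisymm
  · rintro _ ⟨t, rfl⟩
    change γ (Multiplicative.ofAdd t.toAdd) ∈ _
    rw [ofAdd_eq_prod, map_prod]
    refine prod_mem fun i _ => ?_
    rw [map_zpow]
    exact zpow_mem (Subgroup.subset_closure (Set.mem_range_self i)) _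
  · rw [Subgroup.closure_le]
    rintro _ ⟨i, rfl⟩
    exact ⟨_, rfl⟩

/-! ### Lyapunov exponents as linear functionals -/

section Lyapunov

variable {k : ℕ} {K : Type*} [Field K]

/-- The linear functional on `ℝ^k` extending the logarithm of the absolute value of `γ` at `w`. -/
noncomputable def lyapunov (γ : Multiplicative (Fin k → ℤ) →* (𝓞 K)ˣ) (w : InfinitePlace K) :
    (Fin k → ℝ) →ₗ[ℝ] ℝ :=
  ∑ i, Real.log (w (γ (Multiplicative.ofAdd (Pi.single i 1)) : K)) • LinearMap.proj i

theorem lyapunov_apply (γ : Multiplicative (Fin k → ℤ) →* (𝓞 K)ˣ) (w : InfinitePlace K)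
    (x : Fin k → ℝ) : lyapunov γ w x =
      ∑ i, Real.log (w (γ (Multiplicative.ofAdd (Pi.single i 1)) : K)) * x i := by
  simp [lyapunov]

theorem exp_lyapunov (γ : Multiplicative (Fin k → ℤ) →* (𝓞 K)ˣ) (w : InfinitePlace K)
    (t : Fin k → ℤ) : Real.exp (lyapunov γ w fun i => (t i : ℝ)) =
      w (γ (Multiplicative.ofAdd t) : K) := by
  rw [lyapunov_apply, Real.exp_sum, ofAdd_eq_prod t, map_prod]
  have h : ((∏ i, γ (Multiplicative.ofAdd (Pi.single i (1 : ℤ)) ^ t i) : (𝓞 K)ˣ) : K) =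
      ∏ i, (γ (Multiplicative.ofAdd (Pi.single i (1 : ℤ))) : K) ^ t i := by
    simp only [map_zpow, Units.coe_prod, map_prod, Units.coe_zpow]
  rw [h, map_prod]
  refine Finset.prod_congr rfl fun i _ => ?_
  rw [map_zpow₀, mul_comm, ← Real.rpow_intCast, Real.rpow_def_of_pos (Units.pos_at_place _ _),
    mul_comm]

end Lyapunov

/-! ### Maximal rank: total reality, finite index, diagonalization -/

section Cartan

variable {k : ℕ} {α : AffineAction k (k + 1)} {K : Type*} [Field K] [NumberField K]
  {γ : Multiplicative (Fin k → ℤ) →* (𝓞 K)ˣ}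

/-- From $r_1+2r_2\le k+1$ and $k\le r_1+r_2-1$ one gets $r_2=0$; the same count gives equality of
the rank with $k$. -/
theorem IsAssociatedField.isTotallyReal (h : IsAssociatedField α K γ)
    (hα : ∀ t, t ≠ 0 → IsHyperbolic (α.mat t)) : IsTotallyReal K := by
  rw [← nrComplexPlaces_eq_zero_iff]
  have h1 := h.finrank_le
  have h2 := h.le_rank hα
  have h3 := InfinitePlace.card_add_two_mul_card_eq_rank K
  have h4 := InfinitePlace.card_eq_nrRealPlaces_add_nrComplexPlaces K
  have h5 : 0 < Fintype.card (InfinitePlace K) := Fintype.card_pos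
  rw [Units.rank] at h2
  omega

theorem IsAssociatedField.rank_eq (h : IsAssociatedField α K γ)
    (hα : ∀ t, t ≠ 0 → IsHyperbolic (α.mat t)) : Units.rank K = k := by
  have h1 := h.finrank_le
  have h2 := h.le_rank hα
  have h3 := InfinitePlace.card_add_two_mul_card_eq_rank K
  have h4 := InfinitePlace.card_eq_nrRealPlaces_add_nrComplexPlaces K
  have h5 : 0 < Fintype.card (InfinitePlace K) := Fintype.card_pos
  rw [Units.rank] at h2 ⊢
  omega

theorem IsAssociatedField.finiteIndex (h : IsAssociatedField α K γ)
    (hα : ∀ t, t ≠ 0 → IsHyperbolic (α.mat t)) : (unitGroup γ).FiniteIndex := by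
  have hr := h.rank_eq hα
  subst hr
  rw [unitGroup, ← Units.finiteIndex_iff_sup_torsion_finiteIndex, range_eq_closure,
    ← Units.isMaxRank_iff_closure_finiteIndex]
  exact h.linearIndependent_logEmbedding hα

/-- The simultaneous diagonalization of the linear parts of a Cartan action, together with the
expression of its Lyapunov exponents through the regulator. -/
theorem IsAssociatedField.exists_diagonalization (h : IsAssociatedField α K γ)
    (hα : ∀ t, t ≠ 0 → IsHyperbolic (α.mat t)) :
    ∃ (Q : Matrix (Fin (k + 1)) (Fin (k + 1)) ℝ) (lam : Fin (k + 1) → (Fin k → ℤ) → ℝ)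
      (χ : Fin (k + 1) → (Fin k → ℝ) →ₗ[ℝ] ℝ) (L : Matrix (Fin k) (Fin k) ℝ),
      Q.det ≠ 0 ∧
      (∀ t, Q * (α.mat t).map (Int.cast : ℤ → ℝ) = Matrix.diagonal (fun i => lam i t) * Q) ∧
      (∀ i t, |lam i t| = Real.exp (χ i fun j => (t j : ℝ))) ∧
      |L.det| = (unitGroup γ).index * Units.regulator K ∧
      χ 0 = -∑ j : Fin k, χ j.succ ∧
      ∀ j : Fin k, χ j.succ = LinearMap.proj j ∘ₗ Matrix.toLin' L := by
  classical
  have hr := h.rank_eq hα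
  have hreal := h.isTotallyReal hα
  subst hr
  -- The place left out of the regulator determinant gets index `0`; the others are the successors.
  let w' : InfinitePlace K := Classical.arbitrary _
  have hcard : Fintype.card {w : InfinitePlace K // w ≠ w'} = Units.rank K := by
    rw [Fintype.card_subtype_compl, Fintype.card_subtype_eq, Units.rank]
  let e : {w : InfinitePlace K // w ≠ w'} ≃ Fin (Units.rank K) := Fintype.equivFinOfCardEq hcard
  let E : Fin (Units.rank K + 1) ≃ InfinitePlace K :=
    (finSuccEquiv _).trans ((Equiv.optionSubtype _).symm e.symm).val
  have hE : ∀ j : Fin (Units.rank K), E j.succ = (e.symm j).val := fun j => by simp [E]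
  obtain ⟨v, hv0, hv⟩ := h.exists_eigenvector
  let σ : Fin (Units.rank K + 1) → (K →+* ℝ) := fun i =>
    InfinitePlace.embedding_of_isReal (hreal.isReal (E i))
  have hσ : ∀ i x, |σ i x| = E i x := fun i x => InfinitePlace.norm_embedding_of_isReal _ x
  have hσinj : Function.Injective σ := by
    intro i j hij
    apply E.injective
    apply DFunLike.ext
    intro x
    rw [← hσ, ← hσ, hij]
  let P : Matrix (Fin (Units.rank K + 1)) (Fin (Units.rank K + 1)) ℝ :=
    Matrix.of fun a i => σ i (v a)
  have hP : IsUnit P := by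
    rw [← Matrix.linearIndependent_cols_iff_isUnit]
    exact (h.linearIndependent hv0 hv (F := ℝ)).comp σ hσinj
  let lam : Fin (Units.rank K + 1) → (Fin (Units.rank K) → ℤ) → ℝ := fun i t =>
    σ i (γ (Multiplicative.ofAdd t))
  have hAP : ∀ t, (α.mat t).map (Int.cast : ℤ → ℝ) * P =
      P * Matrix.diagonal fun i => lam i t := by
    intro t
    ext a i
    rw [Matrix.mul_diagonal]
    have h1 : (α.mat t).map (Int.cast : ℤ → ℝ) = ((α.mat t).map (Int.cast : ℤ → K)).map (σ i) := by
      ext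
      simp
    have h2 := congrFun (map_mulVec (σ i) ((α.mat t).map (Int.cast : ℤ → K)) v) a
    rw [← h1, hv] at h2
    rw [Matrix.mul_apply]
    refine h2.trans ?_
    exact (map_mul (σ i) _ _).trans (mul_comm _ _)
  have hdet : IsUnit P.det := (Matrix.isUnit_iff_isUnit_det P).1 hP
  refine ⟨P⁻¹, lam, fun i => lyapunov γ (E i), Matrix.of fun j i =>
    Real.log (E j.succ (γ (Multiplicative.ofAdd (Pi.single i 1)) : K)), ?_, ?_, ?_, ?_, ?_, ?_⟩
  · rw [Matrix.det_nonsing_inv]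
    exact (IsUnit.ringInverse hdet).ne_zero
  · intro t
    have := congrArg (fun M => P⁻¹ * M * P⁻¹) (hAP t)
    simp only [Matrix.mul_assoc] at this
    rw [Matrix.mul_nonsing_inv _ hdet, Matrix.mul_one] at this
    rw [this, ← Matrix.mul_assoc, ← Matrix.mul_assoc, Matrix.nonsing_inv_mul _ hdet,
      Matrix.one_mul]
  · intro i t
    rw [hσ, exp_lyapunov]
  -- The regulator of the family of generators is the index of the group it generates with torsion,
  -- times $R_K$; it is also the determinant of the logarithms at the places other than `w'`.
  · have h1 := Units.regOfFamily_div_regulator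
      (fun i => γ (Multiplicative.ofAdd (Pi.single i 1)))
    rw [← range_eq_closure, div_eq_iff (Units.regulator_ne_zero K)] at h1
    rw [unitGroup, ← h1, Units.regOfFamily_eq_det _ w' e, ← Matrix.det_reindex_self e,
      ← Matrix.det_transpose]
    congr 2
    ext i j
    simp [hE]
  · ext i
    -- Product formula for units; all multiplicities are one since $K$ is totally real.
    have h1 := Units.sum_mult_mul_log (γ (Multiplicative.ofAdd (Pi.single i 1)))
    simp only [IsTotallyReal.mult_eq, Nat.cast_one, one_mul] at h1
    rw [← E.sum_comp, Fin.sum_univ_succ] at h1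
    have h2 : ∀ w : InfinitePlace K, (lyapunov γ w) (Pi.single i 1) =
        Real.log (w (γ (Multiplicative.ofAdd (Pi.single i 1)) : K)) := by
      intro w
      simp [lyapunov_apply, Pi.single_apply]
    simp only [LinearMap.comp_apply, LinearMap.neg_apply, LinearMap.sum_apply,
      LinearMap.single_apply]
    simp only [h2]
    linarith
  · intro j
    ext1 i
    ext1
    simp [lyapunov_apply, Pi.single_apply]

end Cartan

/-! ### Norms and dual norms -/

section DualNorm

variable {k : ℕ} {p : Seminorm ℝ (Fin k → ℝ)}

theorem exists_seminorm_le (p : Seminorm ℝ (Fin k → ℝ)) : ∃ M > 0, ∀ x, p x ≤ M * ‖x‖ := by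
  refine ⟨∑ i, p (Pi.single i 1) + 1, by positivity, fun x => ?_⟩
  have hx : x = ∑ i, x i • (Pi.single i (1 : ℝ) : Fin k → ℝ) := by
    ext j
    simp [Finset.sum_apply, Pi.single_apply]
  calc p x = p (∑ i, x i • (Pi.single i (1 : ℝ) : Fin k → ℝ)) := by rw [← hx]
    _ ≤ ∑ i, p (x i • (Pi.single i (1 : ℝ) : Fin k → ℝ)) :=
        Finset.le_sum_of_subadditive p (map_zero p).le (map_add_le_add p) _ _
    _ ≤ ∑ i, ‖x‖ * p (Pi.single i 1) := by
        refine Finset.sum_le_sum fun i _ => ?_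
        rw [map_smul_eq_mul]
        exact mul_le_mul_of_nonneg_right (norm_le_pi_norm x i) (apply_nonneg p _)
    _ ≤ (∑ i, p (Pi.single i 1) + 1) * ‖x‖ := by
        rw [← Finset.mul_sum]
        nlinarith [norm_nonneg x]

theorem continuous_seminorm (p : Seminorm ℝ (Fin k → ℝ)) : Continuous p := by
  obtain ⟨M, hM, h⟩ := exists_seminorm_le p
  have : LipschitzWith ⟨M, hM.le⟩ p := LipschitzWith.of_dist_le_mul fun x y => by
    rw [Real.dist_eq, dist_eq_norm]
    exact (abs_sub_map_le_sub p x y).trans (h _)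
  exact this.continuous

theorem IsNorm.exists_le (hp : IsNorm p) : ∃ m > 0, ∀ x, m * ‖x‖ ≤ p x := by
  by_cases hne : (Metric.sphere (0 : Fin k → ℝ) 1).Nonempty
  · obtain ⟨x₀, hx₀, hmin⟩ := (isCompact_sphere (0 : Fin k → ℝ) 1).exists_isMinOn hne
      (continuous_seminorm p).continuousOn
    have hx₀' : x₀ ≠ 0 := by
      rintro rfl
      simp at hx₀
    refine ⟨p x₀, (apply_nonneg p x₀).lt_of_ne fun h => hx₀' (hp _ h.symm), fun x => ?_⟩
    rcases eq_or_ne x 0 with rfl | hx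
    · simp
    have hx' : 0 < ‖x‖ := norm_pos_iff.2 hx
    have := hmin (show ‖x‖⁻¹ • x ∈ Metric.sphere (0 : Fin k → ℝ) 1 by
      simp [norm_smul, hx'.ne'])
    rw [Set.mem_ofPred_eq, map_smul_eq_mul, norm_inv, norm_norm] at this
    rwa [← le_div_iff₀ hx', div_eq_inv_mul]
  · refine ⟨1, one_pos, fun x => ?_⟩
    rcases eq_or_ne x 0 with rfl | hx
    · simp
    · exact absurd ⟨‖x‖⁻¹ • x, by simp [norm_smul, norm_ne_zero_iff.2 hx]⟩ hne

/-- The dual norm of a linear functional. -/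
noncomputable def dualNorm (p : Seminorm ℝ (Fin k → ℝ)) (l : (Fin k → ℝ) →ₗ[ℝ] ℝ) : ℝ :=
  sSup (l '' {x | p x ≤ 1})

theorem exists_abs_linearMap_le {n : ℕ} (l : (Fin n → ℝ) →ₗ[ℝ] ℝ) :
    ∃ B > 0, ∀ x, |l x| ≤ B * ‖x‖ :=
  (LinearMap.toContinuousLinearMap l).isBoundedLinearMap.bound

theorem IsNorm.bddAbove (hp : IsNorm p) (l : (Fin k → ℝ) →ₗ[ℝ] ℝ) :
    BddAbove (l '' {x | p x ≤ 1}) := by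
  obtain ⟨m, hm, hmp⟩ := hp.exists_le
  obtain ⟨B, hB, hBl⟩ := exists_abs_linearMap_le l
  refine ⟨B * m⁻¹, ?_⟩
  rintro _ ⟨x, hx, rfl⟩
  refine (le_abs_self _).trans ((hBl x).trans (mul_le_mul_of_nonneg_left ?_ hB.le))
  rw [← one_div, le_div_iff₀ hm, mul_comm]
  exact (hmp x).trans hx

theorem IsNorm.le_dualNorm (hp : IsNorm p) (l : (Fin k → ℝ) →ₗ[ℝ] ℝ) {x : Fin k → ℝ}
    (hx : p x ≤ 1) : l x ≤ dualNorm p l :=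
  le_csSup (hp.bddAbove l) ⟨x, hx, rfl⟩

theorem IsNorm.dualNorm_nonneg (hp : IsNorm p) (l : (Fin k → ℝ) →ₗ[ℝ] ℝ) : 0 ≤ dualNorm p l := by
  simpa using hp.le_dualNorm l (x := 0) (by simp)

theorem IsNorm.apply_le (hp : IsNorm p) (l : (Fin k → ℝ) →ₗ[ℝ] ℝ) (x : Fin k → ℝ) :
    l x ≤ dualNorm p l * p x := by
  rcases (apply_nonneg p x).eq_or_lt with h | h
  · rw [hp x h.symm]
    simp
  · have := hp.le_dualNorm l (x := (p x)⁻¹ • x) (by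
      rw [map_smul_eq_mul, norm_inv, Real.norm_of_nonneg h.le, inv_mul_cancel₀ h.ne'])
    rw [map_smul, smul_eq_mul] at this
    rwa [← div_le_iff₀ h, div_eq_inv_mul]

theorem dualNorm_le {l : (Fin k → ℝ) →ₗ[ℝ] ℝ} {c : ℝ} (h : ∀ x, p x ≤ 1 → l x ≤ c) :
    dualNorm p l ≤ c := by
  refine csSup_le ⟨l 0, 0, by simp, rfl⟩ ?_
  rintro _ ⟨x, hx, rfl⟩
  exact h x hx

theorem dualNorm_neg (p : Seminorm ℝ (Fin k → ℝ)) (l : (Fin k → ℝ) →ₗ[ℝ] ℝ) :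
    dualNorm p (-l) = dualNorm p l := by
  unfold dualNorm
  congr 1
  ext c
  constructor <;> rintro ⟨x, hx, rfl⟩ <;> exact ⟨-x, by simpa using hx, by simp⟩

theorem dualNorm_smul (p : Seminorm ℝ (Fin k → ℝ)) (l : (Fin k → ℝ) →ₗ[ℝ] ℝ) {c : ℝ}
    (hc : 0 ≤ c) : dualNorm p (c • l) = c * dualNorm p l := by
  unfold dualNorm
  rw [← smul_eq_mul, ← Real.sSup_smul_of_nonneg hc]
  congr 1
  ext y
  simp [Set.mem_smul_set]

theorem dualNorm_comp (p : Seminorm ℝ (Fin k → ℝ)) (l : (Fin k → ℝ) →ₗ[ℝ] ℝ)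
    {f : (Fin k → ℝ) →ₗ[ℝ] (Fin k → ℝ)} (hf : Function.Surjective f) :
    dualNorm (p.comp f) (l ∘ₗ f) = dualNorm p l := by
  unfold dualNorm
  congr 1
  ext c
  constructor
  · rintro ⟨x, hx, rfl⟩
    exact ⟨f x, hx, rfl⟩
  · rintro ⟨x, hx, rfl⟩
    obtain ⟨y, rfl⟩ := hf x
    exact ⟨y, hx, rfl⟩

/-- A nearly maximizing point can be shrunk slightly. The strict inequality `p x < 1` leaves room
for rational approximation later. -/
theorem exists_lt_apply_of_lt_dualNorm {l : (Fin k → ℝ) →ₗ[ℝ] ℝ} {c : ℝ}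
    (hc : c < dualNorm p l) : ∃ x, p x < 1 ∧ c < l x := by
  obtain ⟨_, ⟨x, hx, rfl⟩, hcx⟩ := exists_lt_of_lt_csSup (⟨l 0, 0, by simp, rfl⟩ :
    (l '' {x | p x ≤ 1}).Nonempty) hc
  have h1 : Tendsto (fun a : ℝ => a * l x) (nhdsWithin 1 (Set.Iio 1)) (nhds (l x)) := by
    have : Continuous fun a : ℝ => a * l x := by fun_prop
    simpa using (this.tendsto 1).mono_left (nhdsWithin_le_nhds (s := Set.Iio 1))
  have h2 : ∀ᶠ a : ℝ in nhdsWithin 1 (Set.Iio 1), 0 < a :=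
    nhdsWithin_le_nhds (lt_mem_nhds one_pos)
  have h3 : ∀ᶠ a : ℝ in nhdsWithin 1 (Set.Iio 1), a < 1 := self_mem_nhdsWithin
  obtain ⟨a, ha, ha1, ha0⟩ := ((h1.eventually (lt_mem_nhds hcx)).and (h3.and h2)).exists
  refine ⟨a • x, ?_, by simpa using ha⟩
  rw [map_smul_eq_mul, Real.norm_of_nonneg ha0.le]
  have hx' : p x ≤ 1 := hx
  nlinarith [apply_nonneg p x]

end DualNorm

/-! ### The constant -/

section Constant

variable {k : ℕ}

/-- The sum of the dual norms of the `k` coordinates and of their sum. -/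
noncomputable def modelCost (p : Seminorm ℝ (Fin k → ℝ)) : ℝ :=
  ∑ j : Fin k, dualNorm p (LinearMap.proj j) + dualNorm p (∑ j : Fin k, LinearMap.proj j)

/-- The infimum of `modelCost` over all norms whose unit ball has Lebesgue measure one. -/
noncomputable def modelConst (k : ℕ) : ℝ :=
  sInf {c | ∃ p : Seminorm ℝ (Fin k → ℝ), IsNorm p ∧ volume {x | p x ≤ 1} = 1 ∧ modelCost p = c}

/-- The unit ball lies in the box with half-sides $a_j$, the dual norms of the coordinates, so
$\prod 2a_j\ge1$. Then $u\le e^{u-1}$ gives $\sum 2a_j\ge k$. The dual norm of the sum is merely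
bounded below by zero. -/
theorem le_modelCost {p : Seminorm ℝ (Fin k → ℝ)} (hp : IsNorm p)
    (hvol : volume {x | p x ≤ 1} = 1) : (k : ℝ) / 2 ≤ modelCost p := by
  set a : Fin k → ℝ := fun j => dualNorm p (LinearMap.proj j) with ha
  have ha0 : ∀ j, 0 ≤ a j := fun j => hp.dualNorm_nonneg _
  have hsub : {x | p x ≤ 1} ⊆ Set.Icc (-a) a := by
    intro x hx
    refine ⟨fun j => ?_, fun j => hp.le_dualNorm (LinearMap.proj j) hx⟩
    have := hp.le_dualNorm (LinearMap.proj j) (x := -x) (by simpa using hx)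
    rw [LinearMap.proj_apply, Pi.neg_apply] at this
    rw [Pi.neg_apply]
    linarith
  have h1 : (1 : ENNReal) ≤ ENNReal.ofReal (∏ j, (2 * a j)) := by
    rw [← hvol]
    refine (measure_mono hsub).trans ?_
    rw [Real.volume_Icc_pi, ← ENNReal.ofReal_prod_of_nonneg]
    · refine ENNReal.ofReal_le_ofReal (le_of_eq (Finset.prod_congr rfl fun j _ => ?_))
      rw [Pi.neg_apply]
      ring
    · intro j _
      rw [Pi.neg_apply]
      linarith [ha0 j]
  rw [ENNReal.one_le_ofReal] at h1
  have h2 : ∏ j, (2 * a j) ≤ Real.exp (∑ j, (2 * a j - 1)) := by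
    rw [Real.exp_sum]
    refine Finset.prod_le_prod (fun j _ => by linarith [ha0 j]) fun j _ => ?_
    linarith [Real.add_one_le_exp (2 * a j - 1)]
  have h3 : 0 ≤ ∑ j, (2 * a j - 1) := Real.one_le_exp_iff.1 (h1.trans h2)
  rw [Finset.sum_sub_distrib, ← Finset.mul_sum] at h3
  simp only [Finset.sum_const, Finset.card_univ, Fintype.card_fin, nsmul_eq_mul, mul_one] at h3
  have h4 := hp.dualNorm_nonneg (∑ j : Fin k, LinearMap.proj j)
  unfold modelCost
  change _ ≤ ∑ j, a j + _
  linarith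

/-- The witness is the norm whose unit ball is the cube of side one: each coordinate costs at most
$1/2$, and their sum at most $k/2$. -/
theorem exists_modelCost_le (k : ℕ) : ∃ p : Seminorm ℝ (Fin k → ℝ), IsNorm p ∧
    volume {x | p x ≤ 1} = 1 ∧ modelCost p ≤ k := by
  let p : Seminorm ℝ (Fin k → ℝ) := (2 : NNReal) • normSeminorm ℝ (Fin k → ℝ)
  have hp : ∀ x, p x = 2 * ‖x‖ := fun x => rfl
  have hc : ∀ x j, p x ≤ 1 → x j ≤ 1 / 2 := by
    intro x j hx
    rw [hp] at hx
    have := (le_abs_self _).trans (norm_le_pi_norm x j)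
    linarith
  refine ⟨p, fun x hx => ?_, ?_, ?_⟩
  · rw [hp] at hx
    simpa using hx
  · have : {x | p x ≤ 1} = Set.Icc (fun _ => -(1 / 2) : Fin k → ℝ) (fun _ => 1 / 2) := by
      ext x
      rw [Set.mem_ofPred_eq, hp, ← le_div_iff₀' two_pos, pi_norm_le_iff_of_nonneg (by norm_num),
        Set.mem_Icc, Pi.le_def, Pi.le_def, ← forall_and]
      exact forall_congr' fun j => abs_le
    rw [this, Real.volume_Icc_pi]
    norm_num
  · have h1 : ∀ j : Fin k, dualNorm p (LinearMap.proj j) ≤ 1 / 2 := fun j =>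
      dualNorm_le fun x hx => hc x j hx
    have h2 : dualNorm p (∑ j : Fin k, LinearMap.proj j) ≤ k / 2 := dualNorm_le fun x hx => by
      simp only [LinearMap.sum_apply, LinearMap.proj_apply]
      refine (Finset.sum_le_sum fun j _ => hc x j hx).trans ?_
      simp [div_eq_mul_inv]
    have h3 := Finset.sum_le_sum fun (j : Fin k) (_ : j ∈ Finset.univ) => h1 j
    simp only [Finset.sum_const, Finset.card_univ, Fintype.card_fin, nsmul_eq_mul] at h3
    unfold modelCost
    linarith

theorem bddBelow_modelCost (k : ℕ) : BddBelow {c | ∃ p : Seminorm ℝ (Fin k → ℝ), IsNorm p ∧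
    volume {x | p x ≤ 1} = 1 ∧ modelCost p = c} := by
  refine ⟨k / 2, ?_⟩
  rintro _ ⟨p, hp, hv, rfl⟩
  exact le_modelCost hp hv

theorem le_modelConst (k : ℕ) : (k : ℝ) / 2 ≤ modelConst k := by
  obtain ⟨p, hp, hv, _⟩ := exists_modelCost_le k
  refine le_csInf ⟨_, p, hp, hv, rfl⟩ ?_
  rintro _ ⟨p, hp, hv, rfl⟩
  exact le_modelCost hp hv

theorem modelConst_le (k : ℕ) : modelConst k ≤ k := by
  obtain ⟨p, hp, hv, h⟩ := exists_modelCost_le k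
  exact (csInf_le (bddBelow_modelCost k) ⟨p, hp, hv, rfl⟩).trans h

theorem IsNorm.comp {p : Seminorm ℝ (Fin k → ℝ)} (hp : IsNorm p)
    {f : (Fin k → ℝ) →ₗ[ℝ] (Fin k → ℝ)} (hf : Function.Injective f) : IsNorm (p.comp f) :=
  fun _ hx => hf ((hp _ hx).trans (map_zero f).symm)

theorem volume_unitBall_comp (p : Seminorm ℝ (Fin k → ℝ))
    {f : (Fin k → ℝ) →ₗ[ℝ] (Fin k → ℝ)} (hf : |LinearMap.det f| = 1) :
    volume {x | p.comp f x ≤ 1} = volume {x | p x ≤ 1} := by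
  have h0 : LinearMap.det f ≠ 0 := by
    intro h
    simp [h] at hf
  have := Measure.addHaar_preimage_linearMap volume h0 {x | p x ≤ 1}
  rw [abs_inv, hf, inv_one, ENNReal.ofReal_one, one_mul] at this
  exact this

/-- The infimum over all norms of the sum of the dual norms of functionals that are related by a
linear change of coordinates to the coordinates and the opposite of their sum. -/
theorem iInf_sum_dualNorm (hk : 0 < k) (χ : Fin (k + 1) → (Fin k → ℝ) →ₗ[ℝ] ℝ)
    (L : Matrix (Fin k) (Fin k) ℝ) {R : ℝ} (hR : 0 < R) (hL : |L.det| = R)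
    (h0 : χ 0 = -∑ j : Fin k, χ j.succ)
    (hs : ∀ j : Fin k, χ j.succ = LinearMap.proj j ∘ₗ Matrix.toLin' L) :
    ⨅ (p : Seminorm ℝ (Fin k → ℝ)) (_ : IsNorm p) (_ : volume {x | p x ≤ 1} = 1),
      ((∑ i, dualNorm p (χ i) : ℝ) : EReal) = ((modelConst k * R ^ (1 / (k : ℝ)) : ℝ) : EReal) := by
  have hk' : (k : ℝ) ≠ 0 := Nat.cast_ne_zero.2 hk.ne'
  -- Dividing `L` by $R^{1/k}$ gives determinant $\pm1$, so composition with `f` preserves the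
  -- normalization of the unit ball.
  set c : ℝ := R ^ (1 / (k : ℝ)) with hc
  have hc0 : 0 < c := Real.rpow_pos_of_pos hR _
  have hck : c ^ k = R := by
    rw [hc, ← Real.rpow_natCast, ← Real.rpow_mul hR.le, one_div, inv_mul_cancel₀ hk',
      Real.rpow_one]
  set f : (Fin k → ℝ) →ₗ[ℝ] (Fin k → ℝ) := c⁻¹ • Matrix.toLin' L with hf
  have hdet : |LinearMap.det f| = 1 := by
    rw [hf, LinearMap.det_smul, LinearMap.det_toLin', abs_mul, hL, Module.finrank_fin_fun, inv_pow,
      hck, abs_of_pos (inv_pos.2 hR), inv_mul_cancel₀ hR.ne']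
  have hdet0 : LinearMap.det f ≠ 0 := by
    intro h
    simp [h] at hdet
  let g : (Fin k → ℝ) ≃ₗ[ℝ] (Fin k → ℝ) := LinearMap.equivOfDetNeZero f hdet0
  have hgf : (g : (Fin k → ℝ) →ₗ[ℝ] (Fin k → ℝ)) = f := rfl
  have hsurj : Function.Surjective f := g.surjective
  have hcost : ∀ p : Seminorm ℝ (Fin k → ℝ),
      ∑ i, dualNorm (p.comp f) (χ i) = c * modelCost p := by
    intro p
    have h1 : ∀ j : Fin k, χ j.succ = c • (LinearMap.proj j ∘ₗ f) := by
      intro j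
      rw [hs, hf, LinearMap.comp_smul, smul_smul, mul_inv_cancel₀ hc0.ne', one_smul]
    have h2 : χ 0 = -(c • ((∑ j : Fin k, LinearMap.proj j) ∘ₗ f)) := by
      rw [h0]
      ext i
      simp [h1, Finset.mul_sum]
    rw [Fin.sum_univ_succ, h2, dualNorm_neg, dualNorm_smul _ _ hc0.le,
      dualNorm_comp _ _ hsurj, modelCost, mul_add, Finset.mul_sum, add_comm]
    congr 1
    refine Finset.sum_congr rfl fun j _ => ?_
    rw [h1, dualNorm_smul _ _ hc0.le, dualNorm_comp _ _ hsurj]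
  have hne : {c | ∃ p : Seminorm ℝ (Fin k → ℝ), IsNorm p ∧
      volume {x | p x ≤ 1} = 1 ∧ modelCost p = c}.Nonempty := by
    obtain ⟨p, hp, hv, _⟩ := exists_modelCost_le k
    exact ⟨_, p, hp, hv, rfl⟩
  apply le_antisymm
  · refine EReal.le_of_forall_lt_iff_le.1 fun z hz => ?_
    have hz' : modelConst k < z / c := by
      rw [lt_div_iff₀ hc0]
      exact_mod_cast hz
    obtain ⟨_, ⟨p, hp, hv, rfl⟩, hlt⟩ := exists_lt_of_csInf_lt hne hz'
    refine (iInf₂_le_of_le (p.comp f) (hp.comp g.injective)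
      (iInf_le_of_le ((volume_unitBall_comp p hdet).trans hv) le_rfl)).trans ?_
    rw [hcost]
    rw [lt_div_iff₀ hc0, mul_comm] at hlt
    exact_mod_cast hlt.le
  · refine le_iInf₂ fun p hp => le_iInf fun hv => ?_
    -- Every norm arises by composition with `f`, so the two infima run over the same norms.
    have hp' : p = (p.comp (g.symm : (Fin k → ℝ) →ₗ[ℝ] (Fin k → ℝ))).comp f := by
      ext x
      rw [← hgf]
      simp
    have hv' : volume {x | p.comp (g.symm : (Fin k → ℝ) →ₗ[ℝ] (Fin k → ℝ)) x ≤ 1} = 1 := by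
      rw [volume_unitBall_comp, hv]
      rw [LinearEquiv.det_coe_symm, hgf, abs_inv, hdet, inv_one]
    rw [hp', hcost, mul_comm]
    refine EReal.coe_le_coe_iff.2 (mul_le_mul_of_nonneg_left ?_ hc0.le)
    exact csInf_le (bddBelow_modelCost k) ⟨_, hp.comp g.symm.injective, hv', rfl⟩

end Constant

/-! ### The torus -/

section Torus

variable {n : ℕ}

instance : IsProbabilityMeasure (volume : Measure UnitAddCircle) := ⟨UnitAddCircle.measure_univ⟩

/-- The projection of `ℝ^n` onto the torus. -/
def torusMk (x : Fin n → ℝ) : Torus n := fun i => (x i : UnitAddCircle)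

theorem torusMk_sub (x y : Fin n → ℝ) : torusMk (x - y) = torusMk x - torusMk y := rfl

theorem torusEnd_sub (M : Matrix (Fin n) (Fin n) ℤ) (x y : Torus n) :
    torusEnd M (x - y) = torusEnd M x - torusEnd M y := by
  ext i
  simp [torusEnd, smul_sub, Finset.sum_sub_distrib]

theorem torusEnd_one (x : Torus n) : torusEnd 1 x = x := by
  ext i
  simp [torusEnd, Matrix.one_apply, ite_smul]

theorem torusEnd_mul (M N : Matrix (Fin n) (Fin n) ℤ) (x : Torus n) :
    torusEnd (M * N) x = torusEnd M (torusEnd N x) := by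
  ext i
  simp only [torusEnd, Matrix.mul_apply, Finset.sum_smul, Finset.smul_sum, mul_smul]
  exact Finset.sum_comm

theorem continuous_torusEnd (M : Matrix (Fin n) (Fin n) ℤ) : Continuous (torusEnd M) := by
  unfold torusEnd
  fun_prop

theorem torusEnd_torusMk (M : Matrix (Fin n) (Fin n) ℤ) (x : Fin n → ℝ) :
    torusEnd M (torusMk x) = torusMk ((M.map (Int.cast : ℤ → ℝ)).mulVec x) := by
  ext i
  simp only [torusEnd, torusMk, Matrix.mulVec, dotProduct, Matrix.map_apply]
  rw [← QuotientAddGroup.mk'_apply, map_sum]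
  refine Finset.sum_congr rfl fun j _ => ?_
  rw [← zsmul_eq_mul, map_zsmul]
  rfl

theorem norm_torusMk_le (x : Fin n → ℝ) : ‖torusMk x‖ ≤ ‖x‖ := by
  refine (pi_norm_le_iff_of_nonneg (norm_nonneg _)).2 fun i => le_trans ?_ (norm_le_pi_norm x i)
  rw [torusMk, UnitAddCircle.norm_eq]
  simpa using round_le (x i) 0

theorem norm_torusMk_eq {x : Fin n → ℝ} (hx : ∀ i, |x i| ≤ 1 / 2) : ‖torusMk x‖ = ‖x‖ := by
  have h : ∀ i, ‖torusMk x i‖ = ‖x i‖ := fun i =>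
    (AddCircle.norm_coe_eq_abs_iff 1 one_ne_zero).2 (by simpa using hx i)
  apply le_antisymm (norm_torusMk_le x)
  refine (pi_norm_le_iff_of_nonneg (norm_nonneg _)).2 fun i => ?_
  rw [← h]
  exact norm_le_pi_norm (torusMk x) i

theorem exists_torusMk_eq (z : Torus n) : ∃ x : Fin n → ℝ, torusMk x = z ∧ ∀ i, |x i| ≤ 1 / 2 := by
  have h : ∀ i, ∃ a : ℝ, (a : UnitAddCircle) = z i ∧ |a| ≤ 1 / 2 := by
    intro i
    obtain ⟨b, hb⟩ := QuotientAddGroup.mk_surjective (z i)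
    refine ⟨b - round b, ?_, abs_sub_round b⟩
    rw [← hb]
    have : ((round b : ℝ) : UnitAddCircle) = 0 := by
      rw [AddCircle.coe_eq_zero_iff]
      exact ⟨round b, by simp⟩
    rw [AddCircle.coe_sub, this, sub_zero]
  choose x hx using h
  exact ⟨x, funext fun i => (hx i).1, fun i => (hx i).2⟩

theorem exists_int_of_torusMk_eq_zero {x : Fin n → ℝ} (hx : torusMk x = 0) :
    ∃ m : Fin n → ℤ, x = fun i => (m i : ℝ) := by
  have h : ∀ i, ∃ a : ℤ, x i = a := by
    intro i
    obtain ⟨a, ha⟩ := (AddCircle.coe_eq_zero_iff 1).1 (congrFun hx i)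
    exact ⟨a, by simpa using ha.symm⟩
  choose m hm using h
  exact ⟨m, funext hm⟩

variable {k : ℕ} (α : AffineAction k n)

/-- The translations cancel: distances along orbits depend only on the linear parts and on `x - y`.
-/
theorem AffineAction.act_sub_act (t : Fin k → ℤ) (x y : Torus n) :
    α.act t x - α.act t y = torusEnd (α.mat t) (x - y) := by
  rw [AffineAction.act, AffineAction.act, add_sub_add_right_eq_sub, torusEnd_sub]

theorem AffineAction.measurePreserving_torusEnd (t : Fin k → ℤ) :
    MeasurePreserving (torusEnd (α.mat t)) (volume : Measure (Torus n)) volume := by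
  let f : Torus n →+ Torus n := AddMonoidHom.ofMapSub (torusEnd (α.mat t)) (torusEnd_sub _)
  have hsurj : Function.Surjective f := fun y => ⟨torusEnd (α.mat (-t)) y, by
    change torusEnd _ (torusEnd _ y) = y
    rw [← torusEnd_mul, ← α.mat_add, add_neg_cancel, α.mat_zero, torusEnd_one]⟩
  exact f.measurePreserving (continuous_torusEnd _) hsurj rfl

theorem AffineAction.measurePreserving_act (t : Fin k → ℤ) :
    MeasurePreserving (α.act t) (volume : Measure (Torus n)) volume :=
  (measurePreserving_add_right volume (α.translation t)).comp (α.measurePreserving_torusEnd t)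

end Torus

/-! ### Counting lattice points -/

section Lattice

variable {k : ℕ} {p : Seminorm ℝ (Fin k → ℝ)}

theorem norm_intCast_le_iff {t : Fin k → ℤ} {a : ℝ} (ha : 0 ≤ a) :
    ‖(fun i => (t i : ℝ))‖ ≤ a ↔ t ∈ Finset.Icc (fun _ => -(⌊a⌋₊ : ℤ)) (fun _ => (⌊a⌋₊ : ℤ)) := by
  rw [pi_norm_le_iff_of_nonneg ha, Finset.mem_Icc, Pi.le_def, Pi.le_def, ← forall_and]
  refine forall_congr' fun i => ?_
  rw [← abs_le, Real.norm_eq_abs, ← Int.cast_abs, Int.natCast_floor_eq_floor ha, Int.le_floor]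

theorem card_intBox (a : ℝ) : (Finset.Icc (fun _ : Fin k => -(⌊a⌋₊ : ℤ))
    (fun _ => (⌊a⌋₊ : ℤ))).card = (2 * ⌊a⌋₊ + 1) ^ k := by
  rw [Pi.card_Icc]
  simp only [Int.card_Icc, Finset.prod_const, Finset.card_univ, Fintype.card_fin]
  congr 1
  omega

theorem IsNorm.latticeBall_subset (hp : IsNorm p) : ∃ m > 0, ∀ s, 0 ≤ s → latticeBall p s ⊆
    ((Finset.Icc (fun _ => -(⌊s / m⌋₊ : ℤ)) (fun _ => (⌊s / m⌋₊ : ℤ)) :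
      Finset (Fin k → ℤ)) : Set (Fin k → ℤ)) := by
  obtain ⟨m, hm, h⟩ := hp.exists_le
  refine ⟨m, hm, fun s hs t ht => ?_⟩
  rw [Finset.mem_coe, ← norm_intCast_le_iff (by positivity), le_div_iff₀' hm]
  exact (h _).trans ht

theorem IsNorm.finite_latticeBall (hp : IsNorm p) (s : ℝ) : (latticeBall p s).Finite := by
  obtain ⟨m, -, h⟩ := hp.latticeBall_subset
  refine (Finset.finite_toSet _).subset ((?_ : latticeBall p s ⊆ latticeBall p |s|).trans
    (h |s| (abs_nonneg s)))
  intro t ht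
  exact (show p _ ≤ s from ht).trans (le_abs_self s)

/-- The number of lattice points in a ball grows at most polynomially. -/
theorem IsNorm.ncard_latticeBall_le (hp : IsNorm p) : ∃ B > 0, ∀ s, 1 ≤ s →
    ((latticeBall p s).ncard : ℝ) ≤ (B * s) ^ k := by
  obtain ⟨m, hm, h⟩ := hp.latticeBall_subset
  refine ⟨2 / m + 1, by positivity, fun s hs => ?_⟩
  have h1 := Set.ncard_le_ncard (h s (by linarith)) (Finset.finite_toSet _)
  rw [Set.ncard_coe_finset, card_intBox] at h1
  calc ((latticeBall p s).ncard : ℝ) ≤ (((2 * ⌊s / m⌋₊ + 1) ^ k : ℕ) : ℝ) := by exact_mod_cast h1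
    _ = (2 * (⌊s / m⌋₊ : ℝ) + 1) ^ k := by push_cast; ring
    _ ≤ ((2 / m + 1) * s) ^ k := by
        refine pow_le_pow_left₀ (by positivity) ?_ k
        have := Nat.floor_le (show 0 ≤ s / m by positivity)
        have h2 : (2 / m + 1) * s = 2 * (s / m) + s := by ring
        rw [h2]
        linarith

/-- Together with the upper count, this bounds the ratio of the numbers of lattice points in balls
of radii `s` and `θ * s` independently of `s`. -/
theorem IsNorm.le_ncard_latticeBall (hp : IsNorm p) : ∃ b > 0, ∀ s, 0 ≤ s →
    (b * s) ^ k ≤ ((latticeBall p s).ncard : ℝ) := by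
  obtain ⟨M, hM, h⟩ := exists_seminorm_le p
  refine ⟨M⁻¹, by positivity, fun s hs => ?_⟩
  have hsub : ((Finset.Icc (fun _ => -(⌊s / M⌋₊ : ℤ)) (fun _ => (⌊s / M⌋₊ : ℤ)) :
      Finset (Fin k → ℤ)) : Set (Fin k → ℤ)) ⊆ latticeBall p s := by
    intro t ht
    rw [Finset.mem_coe, ← norm_intCast_le_iff (by positivity), le_div_iff₀' hM] at ht
    exact (h _).trans ht
  have h1 := Set.ncard_le_ncard hsub (hp.finite_latticeBall s)
  rw [Set.ncard_coe_finset, card_intBox] at h1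
  calc (M⁻¹ * s) ^ k ≤ (2 * (⌊s / M⌋₊ : ℝ) + 1) ^ k := by
        refine pow_le_pow_left₀ (by positivity) ?_ k
        have := (Nat.lt_floor_add_one (s / M)).le
        rw [← div_eq_inv_mul]
        have h2 : (0 : ℝ) ≤ ⌊s / M⌋₊ := Nat.cast_nonneg _
        linarith
    _ = (((2 * ⌊s / M⌋₊ + 1) ^ k : ℕ) : ℝ) := by push_cast; ring
    _ ≤ _ := by exact_mod_cast h1

end Lattice

/-! ### The upper bound -/

section Cover

variable {X : Type*} {k N : ℕ}

theorem hamming_coe (T : (Fin k → ℤ) → X → X) (ξ : X → Fin N) (F : Finset (Fin k → ℤ)) (x y : X) :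
    hamming T ξ F x y = ((F.filter fun t => ξ (T t x) ≠ ξ (T t y)).card : ℝ) / F.card := by
  rw [hamming, Set.ncard_coe_finset, ← Set.ncard_coe_finset (F.filter _), Finset.coe_filter]
  rfl

theorem coverNumber_le_of_le_measure [MeasurableSpace X] {μ : Measure X} {T : (Fin k → ℤ) → X → X}
    {ξ : X → Fin N} {F : Set (Fin k → ℤ)} {ε δ : ℝ} (E : Finset X)
    (h : ENNReal.ofReal (1 - δ) ≤ μ (⋃ x ∈ E, {y | hamming T ξ F x y < ε})) :
    coverNumber μ T ξ F ε δ ≤ E.card :=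
  Nat.sInf_le ⟨E, rfl, h⟩

/-- A labelling for which points of a large set with the same label are Hamming-close provides a
cover by at most as many Hamming balls as there are labels. -/
theorem exists_cover [MeasurableSpace X] (μ : Measure X) (T : (Fin k → ℤ) → X → X)
    (ξ : X → Fin N) (F : Set (Fin k → ℤ)) {ε δ : ℝ} {ι : Type*} (Λ : Finset ι) (f : X → ι)
    {G : Set X} (hf : ∀ x ∈ G, f x ∈ Λ)
    (hG : ENNReal.ofReal (1 - δ) ≤ μ G)
    (h : ∀ x ∈ G, ∀ y ∈ G, f x = f y → hamming T ξ F x y < ε) :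
    ∃ E : Finset X, E.card ≤ Λ.card ∧
      ENNReal.ofReal (1 - δ) ≤ μ (⋃ x ∈ E, {y | hamming T ξ F x y < ε}) := by
  classical
  rcases G.eq_empty_or_nonempty with rfl | ⟨x₀, hx₀⟩
  · exact ⟨∅, by simp, by simpa using hG⟩
  let c : ι → X := fun i => if hi : ∃ x ∈ G, f x = i then hi.choose else x₀
  refine ⟨Λ.image c, Finset.card_image_le, hG.trans (measure_mono fun y hy => ?_)⟩
  have hi : ∃ x ∈ G, f x = f y := ⟨y, hy, rfl⟩
  have hc : c (f y) = hi.choose := dif_pos hi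
  refine Set.mem_biUnion (Finset.mem_coe.2 (Finset.mem_image_of_mem c (hf y hy))) ?_
  rw [hc]
  exact h _ hi.choose_spec.1 y hy hi.choose_spec.2

theorem coverNumber_le_card [MeasurableSpace X] (μ : Measure X) (T : (Fin k → ℤ) → X → X)
    (ξ : X → Fin N) (F : Set (Fin k → ℤ)) {ε δ : ℝ} {ι : Type*} (Λ : Finset ι) (f : X → ι)
    {G : Set X} (hf : ∀ x ∈ G, f x ∈ Λ)
    (hG : ENNReal.ofReal (1 - δ) ≤ μ G)
    (h : ∀ x ∈ G, ∀ y ∈ G, f x = f y → hamming T ξ F x y < ε) :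
    coverNumber μ T ξ F ε δ ≤ Λ.card := by
  obtain ⟨E, hE, hcov⟩ := exists_cover μ T ξ F Λ f hf hG h
  exact (coverNumber_le_of_le_measure E hcov).trans hE

/-- The minimum in the definition of the cover number is attained. -/
theorem exists_card_eq_coverNumber [MeasurableSpace X] (μ : Measure X) [IsProbabilityMeasure μ]
    (T : (Fin k → ℤ) → X → X) (ξ : X → Fin N) (F : Finset (Fin k → ℤ)) {ε δ : ℝ} (hε : 0 < ε)
    (hδ : 0 ≤ δ) : ∃ E : Finset X, E.card = coverNumber μ T ξ F ε δ ∧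
      ENNReal.ofReal (1 - δ) ≤ μ (⋃ x ∈ E, {y | hamming T ξ F x y < ε}) := by
  obtain ⟨E, -, hE⟩ := exists_cover μ T ξ F (ε := ε) (δ := δ) (G := Set.univ)
    (Finset.univ : Finset (F → Fin N)) (fun x t => ξ (T t x)) (fun _ _ => Finset.mem_univ _)
    (by
      rw [measure_univ, ENNReal.ofReal_le_one]
      linarith)
    (fun x _ y _ hxy => by
      rw [hamming_coe, Finset.filter_false_of_mem fun t ht => not_not.2 (congrFun hxy ⟨t, ht⟩)]
      simpa using hε)
  exact Nat.sInf_mem (s := {m : ℕ | ∃ E : Finset X, E.card = m ∧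
    ENNReal.ofReal (1 - δ) ≤ μ (⋃ x ∈ E, {y | hamming T ξ F x y < ε})}) ⟨_, E, rfl, hE⟩

/-- Points with close orbits are Hamming-close, outside a set of small measure. -/
theorem exists_radius_hamming_lt [PseudoMetricSpace X] [CompactSpace X] [MeasurableSpace X]
    [BorelSpace X] (μ : Measure X) [IsProbabilityMeasure μ] {ξ : X → Fin N} (hξ : Measurable ξ)
    {ε δ : ℝ} (hε : 0 < ε) (hδ : 0 < δ) :
    ∃ r > 0, ∀ T : (Fin k → ℤ) → X → X, (∀ t, MeasurePreserving (T t) μ μ) →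
      ∀ F : Finset (Fin k → ℤ), F.Nonempty → ∃ G : Set X, ENNReal.ofReal (1 - δ) ≤ μ G ∧
        ∀ x ∈ G, ∀ y ∈ G, (∀ t ∈ F, dist (T t x) (T t y) < r) → hamming T ξ F x y < ε := by
  -- The label is treated as a real function and approximated in $L^1$ by a continuous one. Markov's
  -- inequality for the orbit sum of the error yields the good set.
  let f : X → ℝ := fun x => ((ξ x : ℕ) : ℝ)
  have hfm : Measurable f := (Measurable.of_discrete (f := fun i : Fin N => ((i : ℕ) : ℝ))).comp hξ
  have hfi : Integrable f μ := by
    refine Integrable.of_bound hfm.aestronglyMeasurable N (ae_of_all _ fun x => ?_)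
    simp only [f, Real.norm_natCast]
    exact_mod_cast (ξ x).2.le
  obtain ⟨g, hg, hgi⟩ := hfi.exists_boundedContinuous_integral_sub_le
    (show 0 < ε * δ / 4 by positivity)
  obtain ⟨r, hr, hgr⟩ := Metric.uniformContinuous_iff.1
    (CompactSpace.uniformContinuous_of_continuous g.continuous) (1 / 2) (by norm_num)
  refine ⟨r, hr, fun T hT F hF => ?_⟩
  let e : X → ℝ := fun x => ‖f x - g x‖
  have hei : Integrable e μ := (hfi.sub hgi).norm
  let S : X → ℝ := fun x => ∑ t ∈ F, e (T t x)
  have hTi : ∀ t, Integrable (fun x => e (T t x)) μ := fun t =>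
    (hT t).integrable_comp_of_integrable hei
  have hSi : Integrable S μ := integrable_finsetSum _ fun t _ => hTi t
  have hF0 : (0 : ℝ) < F.card := by exact_mod_cast hF.card_pos
  have hS : ∫ x, S x ∂μ ≤ F.card * (ε * δ / 4) := by
    simp only [S]
    rw [integral_finsetSum _ fun t _ => hTi t]
    have : ∀ t ∈ F, ∫ x, e (T t x) ∂μ ≤ ε * δ / 4 := by
      intro t _
      have h1 := integral_map (μ := μ) (hT t).measurable.aemeasurable (f := e)
        (by rw [(hT t).map_eq]; exact hei.aestronglyMeasurable)
      rw [← h1, (hT t).map_eq]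
      exact hg
    refine (Finset.sum_le_sum this).trans ?_
    simp
  have hMarkov := mul_meas_ge_le_integral_of_nonneg (μ := μ) (f := S)
    (ae_of_all _ fun x => Finset.sum_nonneg fun t _ => norm_nonneg _) hSi (F.card * (ε / 4))
  refine ⟨{x | S x < F.card * (ε / 4)}, ?_, ?_⟩
  · have h1 : μ.real {x | F.card * (ε / 4) ≤ S x} ≤ δ := by
      have h2 := hMarkov.trans hS
      have h3 : (F.card : ℝ) * (ε * δ / 4) = F.card * (ε / 4) * δ := by ring
      rw [h3] at h2
      exact le_of_mul_le_mul_left h2 (by positivity)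
    have h4 : (1 : ℝ) ≤ μ.real {x | S x < F.card * (ε / 4)} +
        μ.real {x | F.card * (ε / 4) ≤ S x} := by
      rw [← probReal_univ (μ := μ)]
      refine (measureReal_mono ?_).trans (measureReal_union_le _ _)
      intro x _
      exact lt_or_ge (S x) _
    rw [ENNReal.ofReal_le_iff_le_toReal (measure_ne_top _ _)]
    change _ ≤ μ.real _
    linarith
  · intro x hx y hy hxy
    rw [hamming_coe, div_lt_iff₀ hF0]
    have hx' : S x < F.card * (ε / 4) := hx
    have hy' : S y < F.card * (ε / 4) := hy
    -- Different labels differ by at least $1$ while the values of `g` differ by less than $1/2$, so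
    -- the two errors add up to at least $1/2$.
    have h1 : ((F.filter fun t => ξ (T t x) ≠ ξ (T t y)).card : ℝ) ≤ 2 * (S x + S y) := by
      rw [Finset.card_filter]
      push_cast
      simp only [S]
      rw [← Finset.sum_add_distrib, Finset.mul_sum]
      refine Finset.sum_le_sum fun t ht => ?_
      have he : ∀ z, 0 ≤ e z := fun z => norm_nonneg _
      split_ifs with hne
      · have hf1 : 1 ≤ |f (T t x) - f (T t y)| := by
          have : ((ξ (T t x) : ℕ) : ℤ) - ((ξ (T t y) : ℕ) : ℤ) ≠ 0 := by
            intro h0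
            apply hne
            ext
            omega
          have := Int.one_le_abs this
          simp only [f]
          exact_mod_cast this
        have hg1 : |g (T t x) - g (T t y)| < 1 / 2 := hgr (hxy t ht)
        have hx1 : |f (T t x) - g (T t x)| = e (T t x) := rfl
        have hy1 : |f (T t y) - g (T t y)| = e (T t y) := rfl
        have := abs_le.1 hx1.le
        have := abs_le.1 hy1.le
        have := abs_lt.1 hg1
        rcases le_abs.1 hf1 with h | h <;> linarith
      · linarith [he (T t x), he (T t y)]
    have h2 : (F.card : ℝ) * (ε / 4) = F.card * ε / 4 := by ring
    rw [h2] at hx' hy'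
    linarith

end Cover

/-! ### Covers obtained by rounding eigencoordinates -/

section UpperBound

variable {k n : ℕ}

/-- The linear parts of the action are simultaneously diagonalized by the matrix `Q`, with
eigenvalues `lam` and Lyapunov exponents `χ`. -/
structure IsDiagonalization (α : AffineAction k n) (Q : Matrix (Fin n) (Fin n) ℝ)
    (lam : Fin n → (Fin k → ℤ) → ℝ) (χ : Fin n → (Fin k → ℝ) →ₗ[ℝ] ℝ) : Prop where
  det_ne_zero : Q.det ≠ 0
  mul_mat : ∀ t, Q * (α.mat t).map (Int.cast : ℤ → ℝ) = Matrix.diagonal (fun i => lam i t) * Q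
  abs_eq : ∀ i t, |lam i t| = Real.exp (χ i fun j => (t j : ℝ))

theorem exists_norm_mulVec_le (M : Matrix (Fin n) (Fin n) ℝ) :
    ∃ B > 0, ∀ x, ‖M.mulVec x‖ ≤ B * ‖x‖ :=
  (LinearMap.toContinuousLinearMap (Matrix.toLin' M)).isBoundedLinearMap.bound

variable {α : AffineAction k n} {Q : Matrix (Fin n) (Fin n) ℝ} {lam : Fin n → (Fin k → ℤ) → ℝ}
  {χ : Fin n → (Fin k → ℝ) →ₗ[ℝ] ℝ}

theorem IsDiagonalization.mulVec_apply (h : IsDiagonalization α Q lam χ) (t : Fin k → ℤ)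
    (x : Fin n → ℝ) (i : Fin n) :
    Q.mulVec (((α.mat t).map (Int.cast : ℤ → ℝ)).mulVec x) i = lam i t * Q.mulVec x i := by
  rw [Matrix.mulVec_mulVec, h.mul_mat, ← Matrix.mulVec_mulVec, Matrix.mulVec_diagonal]

theorem IsDiagonalization.exists_norm_le (h : IsDiagonalization α Q lam χ) :
    ∃ B > 0, ∀ x, ‖x‖ ≤ B * ‖Q.mulVec x‖ := by
  obtain ⟨B, hB, hBx⟩ := exists_norm_mulVec_le Q⁻¹
  refine ⟨B, hB, fun x => ?_⟩
  have := hBx (Q.mulVec x)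
  rwa [Matrix.mulVec_mulVec, Matrix.nonsing_inv_mul _ (isUnit_iff_ne_zero.2 h.det_ne_zero),
    Matrix.one_mulVec] at this

theorem zero_mem_latticeBall (p : Seminorm ℝ (Fin k → ℝ)) {s : ℝ} (hs : 0 ≤ s) :
    (0 : Fin k → ℤ) ∈ latticeBall p s := by
  have : (fun i => (((0 : Fin k → ℤ) i : ℤ) : ℝ)) = (0 : Fin k → ℝ) := by
    ext
    simp
  change p _ ≤ s
  rwa [this, map_zero]

/-- For `p t ≤ s` the `i`-th eigencoordinate is stretched by at most $e^{sa_i}$, where $a_i$ is the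
dual norm of `χ i`. Rounding it at scale $\rho e^{-sa_i}$ therefore controls the whole orbit and
uses $O(e^{sa_i})$ labels. -/
theorem IsDiagonalization.coverNumber_le (h : IsDiagonalization α Q lam χ)
    {p : Seminorm ℝ (Fin k → ℝ)} (hp : IsNorm p) {N : ℕ} {ξ : Torus n → Fin N}
    (hξ : Measurable ξ) {ε δ : ℝ} (hε : 0 < ε) (hδ : 0 < δ) :
    ∃ C ≥ 1, ∀ s, 0 ≤ s → (coverNumber volume α.act ξ (latticeBall p s) ε δ : ℝ) ≤
      C * Real.exp (s * ∑ i, dualNorm p (χ i)) := by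
  obtain ⟨r, hr, hrad⟩ := exists_radius_hamming_lt (k := k) (volume : Measure (Torus n)) hξ hε hδ
  obtain ⟨B, hB, hBQ⟩ := exists_norm_mulVec_le Q
  obtain ⟨B', hB', hBQ'⟩ := h.exists_norm_le
  choose lift hlift hlift2 using exists_torusMk_eq (n := n)
  -- With this choice, eigencoordinates at most `ρ` mean a vector of norm at most `r / 2`.
  set ρ : ℝ := r / (2 * B') with hρ
  have hρ0 : 0 < ρ := by positivity
  set a : Fin n → ℝ := fun i => dualNorm p (χ i) with ha
  have ha0 : ∀ i, 0 ≤ a i := fun i => hp.dualNorm_nonneg _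
  have hC1 : (1 : ℝ) ≤ 2 * B / ρ + 3 := by
    have : 0 < 2 * B / ρ := by positivity
    linarith
  refine ⟨(2 * B / ρ + 3) ^ n, one_le_pow₀ hC1, fun s hs => ?_⟩
  obtain ⟨F, hF⟩ := (hp.finite_latticeBall s).exists_finset_coe
  have hmem : ∀ t, t ∈ F ↔ p (fun i => (t i : ℝ)) ≤ s := fun t => by
    rw [← Finset.mem_coe, hF]
    rfl
  have hFne : F.Nonempty := ⟨0, by
    rw [← Finset.mem_coe, hF]
    exact zero_mem_latticeBall p hs⟩
  obtain ⟨G, hG, hGh⟩ := hrad α.act α.measurePreserving_act F hFne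
  rw [← hF]
  set m : Fin n → ℕ := fun i => ⌈B * Real.exp (s * a i) / ρ⌉₊ with hm
  have hlab : ∀ x i, |Q.mulVec (lift x) i * Real.exp (s * a i) / ρ| ≤ m i := by
    intro x i
    refine le_trans ?_ (Nat.le_ceil _)
    rw [abs_div, abs_mul, abs_of_pos hρ0, abs_of_pos (Real.exp_pos _)]
    refine div_le_div_of_nonneg_right (mul_le_mul_of_nonneg_right ?_ (Real.exp_pos _).le) hρ0.le
    have h1 : ‖lift x‖ ≤ 1 := (pi_norm_le_iff_of_nonneg zero_le_one).2 fun j =>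
      (hlift2 x j).trans (by norm_num)
    have h2 := (norm_le_pi_norm (Q.mulVec (lift x)) i).trans (hBQ (lift x))
    rw [Real.norm_eq_abs] at h2
    nlinarith
  have hcov : coverNumber volume α.act ξ (F : Set (Fin k → ℤ)) ε δ ≤
      (Finset.Icc (fun i => -(m i : ℤ)) (fun i => (m i : ℤ))).card := by
    refine coverNumber_le_card volume α.act ξ F _
      (fun x i => ⌊Q.mulVec (lift x) i * Real.exp (s * a i) / ρ⌋) (G := G) ?_ hG ?_
    · intro x _
      rw [Finset.mem_Icc]
      refine ⟨fun i => ?_, fun i => ?_⟩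
      · rw [Int.le_floor]
        push_cast
        exact (abs_le.1 (hlab x i)).1
      · have := (Int.floor_le _).trans (abs_le.1 (hlab x i)).2
        exact_mod_cast this
    · intro x hx y hy hxy
      refine hGh x hx y hy fun t ht => ?_
      have hz : ∀ i, |Q.mulVec (lift x - lift y) i| * Real.exp (s * a i) ≤ ρ := by
        intro i
        have h1 := Int.abs_sub_lt_one_of_floor_eq_floor (congrFun hxy i)
        rw [← sub_div, ← sub_mul, abs_div, abs_mul, abs_of_pos hρ0, abs_of_pos (Real.exp_pos _),
          div_lt_one hρ0] at h1
        rw [Matrix.mulVec_sub]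
        exact h1.le
      have hQt : ‖Q.mulVec (((α.mat t).map (Int.cast : ℤ → ℝ)).mulVec (lift x - lift y))‖ ≤ ρ := by
        refine (pi_norm_le_iff_of_nonneg hρ0.le).2 fun i => ?_
        rw [h.mulVec_apply, Real.norm_eq_abs, abs_mul, h.abs_eq, mul_comm]
        refine le_trans (mul_le_mul_of_nonneg_left (Real.exp_le_exp.2 ?_) (abs_nonneg _)) (hz i)
        refine (hp.apply_le (χ i) _).trans ?_
        rw [mul_comm]
        exact mul_le_mul_of_nonneg_right ((hmem t).1 ht) (ha0 i)
      rw [dist_eq_norm, α.act_sub_act, ← hlift x, ← hlift y, ← torusMk_sub,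
        torusEnd_torusMk]
      refine (norm_torusMk_le _).trans_lt ((hBQ' _).trans_lt ?_)
      refine (mul_le_mul_of_nonneg_left hQt hB'.le).trans_lt ?_
      have : B' * ρ = r / 2 := by
        rw [hρ]
        field_simp
      linarith
  have hcard : (Finset.Icc (fun i => -(m i : ℤ)) (fun i => (m i : ℤ))).card =
      ∏ i, (2 * m i + 1) := by
    rw [Pi.card_Icc]
    refine Finset.prod_congr rfl fun i _ => ?_
    rw [Int.card_Icc]
    omega
  rw [hcard] at hcov
  calc (coverNumber volume α.act ξ (F : Set (Fin k → ℤ)) ε δ : ℝ)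
      ≤ ((∏ i, (2 * m i + 1) : ℕ) : ℝ) := by exact_mod_cast hcov
    _ = ∏ i, (2 * (m i : ℝ) + 1) := by push_cast; rfl
    _ ≤ ∏ i : Fin n, ((2 * B / ρ + 3) * Real.exp (s * a i)) := by
        refine Finset.prod_le_prod (fun i _ => by positivity) fun i _ => ?_
        have h1 := (Nat.ceil_lt_add_one
          (show 0 ≤ B * Real.exp (s * a i) / ρ by positivity)).le
        have h2 : 1 ≤ Real.exp (s * a i) := Real.one_le_exp (mul_nonneg hs (ha0 i))
        have h3 : (2 * B / ρ + 3) * Real.exp (s * a i) =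
          2 * (B * Real.exp (s * a i) / ρ) + 3 * Real.exp (s * a i) := by ring
        rw [h3]
        change (m i : ℝ) ≤ _ at h1
        linarith
    _ = (2 * B / ρ + 3) ^ n * Real.exp (s * ∑ i, a i) := by
        rw [Finset.prod_mul_distrib, Finset.mul_sum, Real.exp_sum]
        simp

theorem IsDiagonalization.slowEntropyNorm_le (h : IsDiagonalization α Q lam χ)
    {p : Seminorm ℝ (Fin k → ℝ)} (hp : IsNorm p) :
    slowEntropyNorm (volume : Measure (Torus n)) α.act p ≤
      ((∑ i, dualNorm p (χ i) : ℝ) : EReal) := by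
  refine iSup_le fun N => iSup₂_le fun ξ hξ => iSup₂_le fun ε hε => iSup₂_le fun δ hδ => ?_
  obtain ⟨C, hC, hcov⟩ := h.coverNumber_le hp hξ hε hδ
  set H := ∑ i, dualNorm p (χ i) with hH
  have hH0 : 0 ≤ H := Finset.sum_nonneg fun i _ => hp.dualNorm_nonneg _
  have hlim : Tendsto (fun s : ℝ => ((Real.log C / s + H : ℝ) : EReal)) atTop (nhds (H : EReal)) := by
    refine (continuous_coe_real_ereal.tendsto H).comp ?_
    simpa using (tendsto_const_nhds.div_atTop tendsto_id : Tendsto (fun s : ℝ => Real.log C / s)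
      atTop (nhds 0)).add_const H
  rw [← hlim.limsup_eq]
  refine limsup_le_limsup ?_
  filter_upwards [eventually_gt_atTop 0] with s hs
  rw [EReal.coe_le_coe_iff, div_add' _ _ _ hs.ne']
  refine div_le_div_of_nonneg_right ?_ hs.le
  have h1 : Real.log C + H * s = Real.log (C * Real.exp (s * H)) := by
    rw [Real.log_mul (by positivity) (Real.exp_pos _).ne', Real.log_exp, mul_comm H s]
  rw [h1]
  -- The cover number vanishes when `δ ≥ 1`; then `Real.log 0 = 0`.
  rcases Nat.eq_zero_or_pos (coverNumber volume α.act ξ (latticeBall p s) ε δ) with h0 | h0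
  · rw [h0, Nat.cast_zero, Real.log_zero, ← h1]
    have := Real.log_nonneg hC
    positivity
  · exact Real.log_le_log (by exact_mod_cast h0) (hcov s hs.le)

end UpperBound

/-! ### The lower bound -/

/-- The number of sequences in a finite set with few non-zero terms. -/
theorem card_sparse_le {β : Type*} [DecidableEq β] [Zero β] (Λ : Finset β) (J M : ℕ) {x : ℝ}
    (hx : 0 < x) (hx1 : x ≤ 1) :
    (((Fintype.piFinset fun _ : Fin J => Λ).filter
      fun f => (Finset.univ.filter fun j => f j ≠ 0).card ≤ M).card : ℝ) ≤
      x⁻¹ ^ M * Real.exp (Λ.card * x * J) := by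
  -- Exponential weighting: each non-zero term gets weight `x`, so a sequence being counted has
  -- weight at least `x ^ M`, and the total weight of all sequences factors over the positions.
  rw [inv_pow, ← div_eq_inv_mul, le_div_iff₀ (pow_pos hx M), ← nsmul_eq_mul, ← Finset.sum_const]
  calc ∑ _f ∈ (Fintype.piFinset fun _ : Fin J => Λ).filter
        (fun f => (Finset.univ.filter fun j => f j ≠ 0).card ≤ M), x ^ M
      ≤ ∑ f ∈ (Fintype.piFinset fun _ : Fin J => Λ).filter
        (fun f => (Finset.univ.filter fun j => f j ≠ 0).card ≤ M),
          ∏ j, (if f j ≠ 0 then x else 1) := by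
        refine Finset.sum_le_sum fun f hf => ?_
        rw [Finset.prod_ite, Finset.prod_const, Finset.prod_const_one, mul_one]
        exact pow_le_pow_of_le_one hx.le hx1 (Finset.mem_filter.1 hf).2
    _ ≤ ∑ f ∈ Fintype.piFinset fun _ : Fin J => Λ, ∏ j, (if f j ≠ 0 then x else 1) := by
        refine Finset.sum_le_sum_of_subset_of_nonneg (Finset.filter_subset _ _) fun f _ _ =>
          Finset.prod_nonneg fun j _ => ?_
        split_ifs <;> positivity
    _ = (∑ a ∈ Λ, if a ≠ 0 then x else 1) ^ J := by
        rw [← Finset.prod_univ_sum (fun _ : Fin J => Λ) (fun _ a => if a ≠ 0 then x else (1 : ℝ))]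
        simp
    _ ≤ (Λ.card * x + 1) ^ J := by
        refine pow_le_pow_left₀ (Finset.sum_nonneg fun a _ => by split_ifs <;> positivity) ?_ J
        have : ∀ a ∈ Λ, (if a ≠ 0 then x else 1) ≤ x + if a = 0 then (1 : ℝ) else 0 := by
          intro a _
          split_ifs with h1 h2 <;> simp_all [hx.le]
        refine (Finset.sum_le_sum this).trans ?_
        rw [Finset.sum_add_distrib, Finset.sum_const, nsmul_eq_mul, Finset.sum_ite_eq']
        split_ifs <;> linarith
    _ ≤ Real.exp (Λ.card * x) ^ J :=
        pow_le_pow_left₀ (by positivity) (Real.add_one_le_exp _) J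
    _ = Real.exp (Λ.card * x * J) := by rw [← Real.exp_nat_mul, mul_comm]

/-! ### Sparse coding along an eigendirection -/

section Coding

variable {n : ℕ}

/-- The coordinate along an eigendirection of a point of the torus is determined, up to an
exponentially small error, by an integer sequence which vanishes as long as the orbit of the
point stays close to the origin. -/
theorem exists_sparse_coding {A : Matrix (Fin n) (Fin n) ℤ} {l : (Fin n → ℝ) →ₗ[ℝ] ℝ}
    {c a r B : ℝ} (hc : c ≠ 0)
    (hl : ∀ y, l ((A.map (Int.cast : ℤ → ℝ)).mulVec y) = c * l y) (ha : 0 ≤ a)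
    (hA : ∀ y, ‖(A.map (Int.cast : ℤ → ℝ)).mulVec y‖ ≤ a * ‖y‖) (hr : (a + 1) * r < 1)
    (hB0 : 0 ≤ B) (hB : ∀ y, |l y| ≤ B * ‖y‖) (z : ℕ → Torus n) (hz : ∀ j, z (j + 1) = torusEnd A (z j))
    {w : Fin n → ℝ} (hw : torusMk w = z 0) (hw2 : ∀ i, |w i| ≤ 1 / 2) {J b : ℕ}
    (hb : ((Finset.range (J + 1)).filter fun j => r ≤ ‖z j‖).card ≤ b) :
    ∃ f : Fin J → Fin n → ℤ,
      (∀ j, f j ∈ Finset.Icc (fun _ => -(⌊a + 1⌋₊ : ℤ)) (fun _ => (⌊a + 1⌋₊ : ℤ))) ∧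
      (Finset.univ.filter fun j => f j ≠ 0).card ≤ 2 * b ∧
      |l w - ∑ j : Fin J, c⁻¹ ^ ((j : ℕ) + 1) * l (fun i => (f j i : ℝ))| ≤ B * |c|⁻¹ ^ J := by
  classical
  choose lift hlift hlift2 using exists_torusMk_eq (n := n)
  -- The initial lift has to be the given `w`: lifts in the closed cube are not unique on its
  -- boundary.
  let y : ℕ → Fin n → ℝ := fun j => if j = 0 then w else lift (z j)
  have hy : ∀ j, torusMk (y j) = z j := by
    intro j
    by_cases hj : j = 0
    · simp [y, hj, hw]
    · simp [y, hj, hlift]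
  have hy2 : ∀ j i, |y j i| ≤ 1 / 2 := by
    intro j i
    by_cases hj : j = 0
    · simpa [y, hj] using hw2 i
    · simpa [y, hj] using hlift2 (z j) i
  have hnorm : ∀ j, ‖y j‖ = ‖z j‖ := fun j => by rw [← hy, norm_torusMk_eq (hy2 j)]
  have hhalf : ∀ j, ‖y j‖ ≤ 1 / 2 := fun j =>
    (pi_norm_le_iff_of_nonneg (by norm_num)).2 fun i => hy2 j i
  have hint : ∀ j, ∃ m : Fin n → ℤ,
      (A.map (Int.cast : ℤ → ℝ)).mulVec (y j) - y (j + 1) = fun i => (m i : ℝ) := by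
    intro j
    apply exists_int_of_torusMk_eq_zero
    rw [torusMk_sub, ← torusEnd_torusMk, hy, hy, hz, sub_self]
  choose g hg using hint
  have hgn : ∀ j, ‖(fun i => (g j i : ℝ))‖ ≤ a * ‖y j‖ + ‖y (j + 1)‖ := fun j => by
    rw [← hg]
    exact (norm_sub_le _ _).trans (add_le_add_left (hA _) _)
  -- Telescoping of `l (y j) = c⁻¹ * (l (g j) + l (y (j + 1)))`.
  have hsum : ∀ m, l w = ∑ j ∈ Finset.range m, c⁻¹ ^ (j + 1) * l (fun i => (g j i : ℝ)) +
      c⁻¹ ^ m * l (y m) := by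
    intro m
    induction m with
    | zero => simp [y]
    | succ m ih =>
      rw [ih, Finset.sum_range_succ, ← hg m, map_sub, hl, pow_succ]
      field_simp
      ring
  refine ⟨fun j => g j, fun j => ?_, ?_, ?_⟩
  · rw [← norm_intCast_le_iff (by positivity)]
    refine (hgn j).trans ?_
    nlinarith [hhalf j, hhalf (j + 1)]
  · set bad := (Finset.range (J + 1)).filter fun j => r ≤ ‖z j‖ with hbad
    -- If the orbit is within `r` of the origin at both times `j` and `j + 1`, the integer vector `g
    -- j` has norm below $1$ and vanishes. So each bad time spoils at most two terms, whence `2 *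
    -- b`.
    have hsub : (Finset.univ.filter fun j : Fin J => g j ≠ 0).image Fin.val ⊆
        bad ∪ bad.image fun j => j - 1 := by
      intro m hm
      obtain ⟨j, hj, rfl⟩ := Finset.mem_image.1 hm
      have hj0 : g j ≠ 0 := (Finset.mem_filter.1 hj).2
      have hor : r ≤ ‖z j‖ ∨ r ≤ ‖z (j + 1)‖ := by
        by_contra! hcon
        apply hj0
        have hlt : ‖(fun i => (g j i : ℝ))‖ < 1 := by
          refine (hgn j).trans_lt ?_
          rw [hnorm, hnorm]
          nlinarith [mul_le_mul_of_nonneg_left hcon.1.le ha]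
        ext i
        have h1 := (norm_le_pi_norm (fun i => (g j i : ℝ)) i).trans_lt hlt
        rw [Real.norm_eq_abs] at h1
        exact Int.abs_lt_one_iff.1 (by exact_mod_cast h1)
      rw [Finset.mem_union, Finset.mem_image]
      have := j.2
      rcases hor with h | h
      · exact Or.inl (Finset.mem_filter.2 ⟨Finset.mem_range.2 (by omega), h⟩)
      · exact Or.inr ⟨j + 1, Finset.mem_filter.2 ⟨Finset.mem_range.2 (by omega), h⟩, by simp⟩
    have h1 := Finset.card_le_card hsub
    rw [Finset.card_image_of_injective _ Fin.val_injective] at h1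
    have h2 := Finset.card_union_le bad (bad.image fun j => j - 1)
    have h3 : (bad.image fun j => j - 1).card ≤ bad.card := Finset.card_image_le
    refine le_trans h1 ?_
    omega
  · rw [hsum J, Fin.sum_univ_eq_sum_range
      (fun j => c⁻¹ ^ (j + 1) * l (fun i => (g j i : ℝ))), add_sub_cancel_left, abs_mul, abs_pow,
      abs_inv, mul_comm]
    refine mul_le_mul_of_nonneg_right ?_ (by positivity)
    refine (hB _).trans ?_
    nlinarith [hhalf J]

end Coding

/-- A compact metric space has finite measurable partitions into pieces of small diameter. -/
theorem exists_fine_partition (X : Type*) [PseudoMetricSpace X] [CompactSpace X] [Nonempty X]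
    [MeasurableSpace X] [BorelSpace X] {r : ℝ} (hr : 0 < r) :
    ∃ (N : ℕ) (ξ : X → Fin N), Measurable ξ ∧ ∀ x y, ξ x = ξ y → dist x y < r := by
  classical
  let c := TopologicalSpace.denseSeq X
  have hc : ∀ x, ∃ i, x ∈ Metric.ball (c i) (r / 2) := by
    intro x
    obtain ⟨_, hy, i, rfl⟩ := (TopologicalSpace.denseRange_denseSeq X).inter_open_nonempty
      (Metric.ball x (r / 2)) Metric.isOpen_ball ⟨x, Metric.mem_ball_self (by positivity)⟩
    exact ⟨i, Metric.mem_ball_comm.1 hy⟩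
  obtain ⟨t, ht⟩ := isCompact_univ.elim_finite_subcover (fun i => Metric.ball (c i) (r / 2))
    (fun i => Metric.isOpen_ball) (fun x _ => Set.mem_iUnion.2 (hc x))
  have hlt : ∀ x, Nat.find (hc x) < t.sup id + 1 := by
    intro x
    obtain ⟨i, hi, hxi⟩ := Set.mem_iUnion₂.1 (ht (Set.mem_univ x))
    exact Nat.lt_succ_of_le ((Nat.find_min' (hc x) hxi).trans (Finset.le_sup (f := id) hi))
  have hm : Measurable fun x => Nat.find (hc x) :=
    measurable_find hc fun i => Metric.isOpen_ball.measurableSet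
  refine ⟨t.sup id + 1, fun x => ⟨Nat.find (hc x), hlt x⟩, ?_, fun x y hxy => ?_⟩
  · refine measurable_to_countable' fun i => ?_
    convert hm (measurableSet_singleton (i : ℕ)) using 1
    ext x
    simp [Fin.ext_iff]
  · have h1 := Nat.find_spec (hc x)
    have h2 := Nat.find_spec (hc y)
    have h3 : Nat.find (hc x) = Nat.find (hc y) := by simpa using hxy
    rw [h3] at h1
    have := dist_triangle_right x y (c (Nat.find (hc y)))
    rw [Metric.mem_ball] at h1 h2
    linarith

/-! ### Measure of Hamming balls and the lower bound -/

section LowerBound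

variable {k n : ℕ}

theorem measurePreserving_torusMk : MeasurePreserving (torusMk (n := n))
    (volume.restrict (Set.univ.pi fun _ => Set.Ioc (-(1 / 2) : ℝ) (-(1 / 2) + 1))) volume := by
  have := measurePreserving_pi (fun _ : Fin n => volume.restrict (Set.Ioc (-(1 / 2) : ℝ)
    (-(1 / 2) + 1))) (fun _ : Fin n => (volume : Measure UnitAddCircle))
    (fun _ => UnitAddCircle.measurePreserving_mk (-(1 / 2)))
  rw [← Measure.restrict_pi_pi] at this
  exact this

/-- The points of the torus whose orbits along the multiples `0, …, J` of each of the elements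
`τ i` leave the ball of radius `r` at most `b` times. -/
def nearOrigin (α : AffineAction k n) (τ : Fin n → Fin k → ℤ) (r : ℝ) (J b : ℕ) :
    Set (Torus n) :=
  {z | ∀ i, ((Finset.range (J + 1)).filter
    fun j : ℕ => r ≤ ‖torusEnd (α.mat (j • τ i)) z‖).card ≤ b}

theorem measurableSet_nearOrigin (α : AffineAction k n) (τ : Fin n → Fin k → ℤ) (r : ℝ)
    (J b : ℕ) : MeasurableSet (nearOrigin α τ r J b) := by
  have : nearOrigin α τ r J b = ⋂ i, {z | ∑ j ∈ Finset.range (J + 1),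
      (if r ≤ ‖torusEnd (α.mat (j • τ i)) z‖ then 1 else 0) ≤ b} := by
    ext z
    simp only [nearOrigin, Finset.card_filter, Set.mem_iInter, Set.mem_ofPred_eq]
  rw [this]
  refine MeasurableSet.iInter fun i => measurableSet_le ?_ measurable_const
  refine Finset.measurable_sum _ fun j _ => ?_
  refine Measurable.ite ?_ measurable_const measurable_const
  exact measurableSet_le measurable_const (continuous_torusEnd _).measurable.norm

variable {α : AffineAction k n} {Q : Matrix (Fin n) (Fin n) ℝ} {lam : Fin n → (Fin k → ℤ) → ℝ}
  {χ : Fin n → (Fin k → ℝ) →ₗ[ℝ] ℝ}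

/-- Sparse coding along `τ i` confines the `i`-th eigencoordinate to a union of few short intervals.
The lift of the set to the fundamental cube thus lies in the preimage under `Q` of a product of such
unions. -/
theorem IsDiagonalization.volume_nearOrigin_le (h : IsDiagonalization α Q lam χ)
    (τ : Fin n → Fin k → ℤ) : ∃ r > 0, ∃ D > 0, ∃ L : ℕ, ∀ x : ℝ, 0 < x → x ≤ 1 → ∀ J b : ℕ,
      volume (nearOrigin α τ r J b) ≤ ENNReal.ofReal (D * ∏ i, (x⁻¹ ^ (2 * b) *
        Real.exp (L * x * J) * Real.exp (-χ i fun l => (τ i l : ℝ)) ^ J)) := by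
  classical
  choose a ha haA using fun i => exists_norm_mulVec_le ((α.mat (τ i)).map (Int.cast : ℤ → ℝ))
  set a' : ℝ := ∑ i, a i with ha'
  have haa : ∀ i, a i ≤ a' := fun i =>
    Finset.single_le_sum (fun j _ => (ha j).le) (Finset.mem_univ i)
  have ha'0 : 0 ≤ a' := Finset.sum_nonneg fun i _ => (ha i).le
  obtain ⟨B, hB, hBQ⟩ := exists_norm_mulVec_le Q
  set Λ : Finset (Fin n → ℤ) :=
    Finset.Icc (fun _ => -(⌊a' + 1⌋₊ : ℤ)) (fun _ => (⌊a' + 1⌋₊ : ℤ)) with hΛ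
  -- Half of the threshold `1 / (a' + 1)` of the coding, with `a'` serving all the `τ i` at once.
  set r : ℝ := 1 / (2 * (a' + 1)) with hr
  have hr0 : 0 < r := by positivity
  have hr1 : (a' + 1) * r < 1 := by
    rw [hr]
    field_simp
    norm_num
  refine ⟨r, hr0, |Q.det|⁻¹ * ∏ _i : Fin n, (2 * B),
    mul_pos (inv_pos.2 (abs_pos.2 h.det_ne_zero)) (Finset.prod_pos fun _ _ => by positivity),
    Λ.card, fun x hx hx1 J b => ?_⟩
  let l : Fin n → (Fin n → ℝ) →ₗ[ℝ] ℝ := fun i => LinearMap.proj i ∘ₗ Matrix.toLin' Q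
  have hlQ : ∀ i y, l i y = Q.mulVec y i := fun i y => rfl
  let S : Finset (Fin J → Fin n → ℤ) := (Fintype.piFinset fun _ : Fin J => Λ).filter
      fun f => (Finset.univ.filter fun j => f j ≠ 0).card ≤ 2 * b
  let c : Fin n → (Fin J → Fin n → ℤ) → ℝ := fun i f =>
    ∑ j : Fin J, (lam i (τ i))⁻¹ ^ ((j : ℕ) + 1) * l i (fun m => (f j m : ℝ))
  let d : Fin n → ℝ := fun i => B * Real.exp (-χ i fun l => (τ i l : ℝ)) ^ J
  have hd : ∀ i, 0 ≤ d i := fun i => by positivity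
  let I : Fin n → Set ℝ := fun i => ⋃ f ∈ S, Set.Icc (c i f - d i) (c i f + d i)
  have hI : ∀ i, volume (I i) ≤ ENNReal.ofReal ((2 * B) * (x⁻¹ ^ (2 * b) *
        Real.exp (Λ.card * x * J) * Real.exp (-χ i fun l => (τ i l : ℝ)) ^ J)) := by
    intro i
    refine (measure_biUnion_finset_le S _).trans ?_
    simp only [Real.volume_Icc]
    have h1 : ∀ f, c i f + d i - (c i f - d i) = 2 * d i := fun f => by ring
    simp only [h1]
    rw [Finset.sum_const, nsmul_eq_mul, ← ENNReal.ofReal_natCast,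
      ← ENNReal.ofReal_mul (Nat.cast_nonneg _)]
    refine ENNReal.ofReal_le_ofReal ?_
    refine (mul_le_mul_of_nonneg_right (card_sparse_le Λ J (2 * b) hx hx1)
      (by linarith [hd i])).trans (le_of_eq ?_)
    simp only [d]
    ring
  have hsub : torusMk ⁻¹' nearOrigin α τ r J b ∩
      (Set.univ.pi fun _ => Set.Ioc (-(1 / 2) : ℝ) (-(1 / 2) + 1)) ⊆
      Matrix.toLin' Q ⁻¹' Set.univ.pi I := by
    rintro w ⟨hw, hwbox⟩ i -
    have hw2 : ∀ m, |w m| ≤ 1 / 2 := fun m => by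
      have := hwbox m (Set.mem_univ m)
      rw [abs_le]
      exact ⟨this.1.le, by linarith [this.2]⟩
    have hlam : lam i (τ i) ≠ 0 := by
      rw [← abs_pos, h.abs_eq]
      exact Real.exp_pos _
    obtain ⟨f, hf1, hf2, hf3⟩ := exists_sparse_coding (A := α.mat (τ i)) (l := l i)
      (c := lam i (τ i)) (a := a') (r := r) (B := B) hlam
      (fun y => by rw [hlQ, h.mulVec_apply, hlQ]) ha'0
      (fun y => (haA i y).trans (mul_le_mul_of_nonneg_right (haa i) (norm_nonneg _))) hr1 hB.le
      (fun y => by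
        rw [hlQ, ← Real.norm_eq_abs]
        exact (norm_le_pi_norm _ i).trans (hBQ y))
      (fun j => torusEnd (α.mat (j • τ i)) (torusMk w))
      (fun j => by rw [← torusEnd_mul, ← α.mat_add, succ_nsmul'])
      (w := w) (by rw [zero_smul, α.mat_zero, torusEnd_one]) hw2 (hw i)
    refine Set.mem_biUnion (x := f) ?_ ?_
    · exact Finset.mem_coe.2 (Finset.mem_filter.2 ⟨Fintype.mem_piFinset.2 hf1, hf2⟩)
    · rw [h.abs_eq, ← Real.exp_neg, abs_le] at hf3
      change l i w - c i f ≥ -d i ∧ l i w - c i f ≤ d i at hf3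
      change l i w ∈ _
      exact ⟨by linarith [hf3.1], by linarith [hf3.2]⟩
  have hdet : LinearMap.det (Matrix.toLin' Q) ≠ 0 := by
    rw [LinearMap.det_toLin']
    exact h.det_ne_zero
  have hbox : MeasurableSet (Set.univ.pi fun _ : Fin n => Set.Ioc (-(1 / 2) : ℝ) (-(1 / 2) + 1)) :=
    MeasurableSet.univ_pi fun _ => measurableSet_Ioc
  rw [← measurePreserving_torusMk.measure_preimage
    (measurableSet_nearOrigin α τ r J b).nullMeasurableSet, Measure.restrict_apply' hbox]
  refine (measure_mono hsub).trans ?_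
  rw [Measure.addHaar_preimage_linearMap volume hdet, LinearMap.det_toLin', volume_pi_pi, mul_assoc,
    ← Finset.prod_mul_distrib, abs_inv, ENNReal.ofReal_mul (by positivity),
    ENNReal.ofReal_prod_of_nonneg fun i _ => by positivity]
  gcongr with i
  exact hI i

/-- Every Hamming ball lies in a union of few preimages of the set `nearOrigin`. -/
theorem volume_hamming_ball_le (α : AffineAction k n) {p : Seminorm ℝ (Fin k → ℝ)} (hp : IsNorm p)
    {τ : Fin n → Fin k → ℤ} {q : ℕ} {θ : ℝ}
    (hθ0 : 0 ≤ θ) (hθ1 : θ ≤ 1) (hτ : ∀ i, p (fun l => (τ i l : ℝ)) ≤ (1 - θ) * q) {r : ℝ} {N : ℕ}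
    {ξ : Torus n → Fin N} (hξ : ∀ x y, ξ x = ξ y → dist x y < r) {s ε β : ℝ} (hs : 0 ≤ s)
    {J : ℕ} (hJ : J * q ≤ s) (hβ : n * ε * (latticeBall p s).ncard ≤
      β * (latticeBall p (θ * s)).ncard) (x : Torus n) :
    volume {y | hamming α.act ξ (latticeBall p s) x y < ε} ≤
      (latticeBall p s).ncard * volume (nearOrigin α τ r J ⌊β * (J + 1)⌋₊) := by
  classical
  obtain ⟨F, hF⟩ := (hp.finite_latticeBall s).exists_finset_coe
  obtain ⟨F', hF'⟩ := (hp.finite_latticeBall (θ * s)).exists_finset_coe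
  rw [← hF, ← hF', Set.ncard_coe_finset, Set.ncard_coe_finset] at hβ
  rw [← hF, Set.ncard_coe_finset]
  have hmem : ∀ t, t ∈ F ↔ p (fun i => (t i : ℝ)) ≤ s := fun t => by
    rw [← Finset.mem_coe, hF]
    rfl
  have hmem' : ∀ t, t ∈ F' ↔ p (fun i => (t i : ℝ)) ≤ θ * s := fun t => by
    rw [← Finset.mem_coe, hF']
    rfl
  have hF'F : F' ⊆ F := fun t ht => by
    rw [hmem]
    exact ((hmem' t).1 ht).trans (mul_le_of_le_one_left hs hθ1)
  have hF'0 : F'.Nonempty := ⟨0, by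
    rw [← Finset.mem_coe, hF']
    exact zero_mem_latticeBall p (mul_nonneg hθ0 hs)⟩
  -- Starting in the smaller ball, the progression stays in the larger one: $\theta
  -- s+J(1-\theta)q\le s$.
  have hpath : ∀ u ∈ F', ∀ i, ∀ j ∈ Finset.range (J + 1), u + j • τ i ∈ F := by
    intro u hu i j hj
    rw [hmem]
    have h1 : (fun l => (((u + j • τ i) l : ℤ) : ℝ)) =
        (fun l => (u l : ℝ)) + (j : ℝ) • fun l => (τ i l : ℝ) := by
      ext l
      simp
    rw [h1]
    refine (map_add_le_add p _ _).trans ?_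
    rw [map_smul_eq_mul, Real.norm_natCast]
    have h2 : (j : ℝ) ≤ J := by exact_mod_cast Finset.mem_range_succ_iff.1 hj
    have h3 : (j : ℝ) * p (fun l => (τ i l : ℝ)) ≤ J * ((1 - θ) * q) :=
      mul_le_mul h2 (hτ i) (apply_nonneg p _) (Nat.cast_nonneg _)
    have h4 : (J : ℝ) * ((1 - θ) * q) ≤ (1 - θ) * s := by
      have := mul_le_mul_of_nonneg_left hJ (sub_nonneg.2 hθ1)
      linarith
    linarith [(hmem' u).1 hu]
  have hsub : {y | hamming α.act ξ (F : Set (Fin k → ℤ)) x y < ε} ⊆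
      ⋃ u ∈ F', (fun y => torusEnd (α.mat u) (y - x)) ⁻¹'
        nearOrigin α τ r J ⌊β * (J + 1)⌋₊ := by
    intro y hy
    rw [Set.mem_ofPred_eq, hamming_coe,
      div_lt_iff₀ (by exact_mod_cast (hF'0.mono hF'F).card_pos)] at hy
    set bad := F.filter fun t => r ≤ ‖torusEnd (α.mat t) (y - x)‖ with hbad
    have hbadle : (bad.card : ℝ) ≤ ε * F.card := by
      refine le_trans ?_ hy.le
      refine Nat.cast_le.2 (Finset.card_le_card fun t ht => ?_)
      obtain ⟨htF, ht⟩ := Finset.mem_filter.1 ht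
      refine Finset.mem_filter.2 ⟨htF, fun heq => ?_⟩
      have := hξ _ _ heq
      rw [dist_comm, dist_eq_norm, α.act_sub_act] at this
      linarith
    -- Double counting: for fixed `i` and `j` the translation by `j • τ i` is injective, so the
    -- counts sum to at most $n(J+1)$ times the number of bad times. Some starting point `u` is then
    -- at most average, and serves all `i` simultaneously.
    let cnt : (Fin k → ℤ) → Fin n → ℕ := fun u i =>
      ((Finset.range (J + 1)).filter fun j => u + j • τ i ∈ bad).card
    have hsum : ∑ u ∈ F', ∑ i, cnt u i ≤ n * ((J + 1) * bad.card) := by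
      rw [Finset.sum_comm]
      have : ∀ i ∈ (Finset.univ : Finset (Fin n)), ∑ u ∈ F', cnt u i ≤ (J + 1) * bad.card := by
        intro i _
        simp only [cnt, Finset.card_filter]
        rw [Finset.sum_comm]
        have hj : ∀ j ∈ Finset.range (J + 1),
            ∑ u ∈ F', (if u + j • τ i ∈ bad then 1 else 0) ≤ bad.card := by
          intro j _
          rw [← Finset.card_filter]
          refine Finset.card_le_card_of_injOn (fun u => u + j • τ i) ?_ ?_
          · intro u hu
            exact (Finset.mem_filter.1 hu).2
          · intro u _ v _ huv
            exact add_right_cancel huv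
        refine (Finset.sum_le_sum hj).trans ?_
        simp
      refine (Finset.sum_le_sum this).trans ?_
      simp
    have hex : ∃ u ∈ F', ((∑ i, cnt u i : ℕ) : ℝ) ≤ β * (J + 1) := by
      by_contra! hcon
      have h1 : ∑ _u ∈ F', (β * (J + 1)) < ∑ u ∈ F', ((∑ i, cnt u i : ℕ) : ℝ) :=
        Finset.sum_lt_sum_of_nonempty hF'0 hcon
      rw [← Nat.cast_sum, Finset.sum_const, nsmul_eq_mul] at h1
      have h2 : ((∑ u ∈ F', ∑ i, cnt u i : ℕ) : ℝ) ≤ n * ((J + 1) * bad.card) := by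
        exact_mod_cast hsum
      have h3 : (n : ℝ) * ((J + 1) * bad.card) ≤ (J + 1) * (n * ε * F.card) := by
        have := mul_le_mul_of_nonneg_left hbadle (show (0 : ℝ) ≤ n * (J + 1) by positivity)
        linarith
      have h4 := mul_le_mul_of_nonneg_left hβ (show (0 : ℝ) ≤ J + 1 by positivity)
      linarith
    obtain ⟨u, hu, hcnt⟩ := hex
    refine Set.mem_biUnion (Finset.mem_coe.2 hu) fun i => ?_
    have h1 : cnt u i ≤ ⌊β * (J + 1)⌋₊ := by
      refine Nat.le_floor (le_trans ?_ hcnt)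
      exact_mod_cast Finset.single_le_sum (f := cnt u) (fun _ _ => Nat.zero_le _)
        (Finset.mem_univ i)
    refine le_trans (Finset.card_le_card fun j hj => ?_) h1
    obtain ⟨hjJ, hj⟩ := Finset.mem_filter.1 hj
    refine Finset.mem_filter.2 ⟨hjJ, Finset.mem_filter.2 ⟨hpath u hu i j hjJ, ?_⟩⟩
    rwa [add_comm u, α.mat_add, torusEnd_mul]
  refine (measure_mono hsub).trans ((measure_biUnion_finset_le _ _).trans ?_)
  have hpre : ∀ u, volume ((fun y => torusEnd (α.mat u) (y - x)) ⁻¹'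
      nearOrigin α τ r J ⌊β * (J + 1)⌋₊) = volume (nearOrigin α τ r J ⌊β * (J + 1)⌋₊) := fun u =>
    ((α.measurePreserving_torusEnd u).comp (measurePreserving_sub_right volume x)).measure_preimage
      (measurableSet_nearOrigin _ _ _ _ _).nullMeasurableSet
  simp only [hpre]
  rw [Finset.sum_const, nsmul_eq_mul]
  gcongr

theorem tendsto_floor_mul_div (y : Fin k → ℝ) :
    Tendsto (fun q : ℕ => (fun l => (⌊q * y l⌋ : ℝ) / q : Fin k → ℝ)) atTop (nhds y) := by
  refine tendsto_pi_nhds.2 fun l => ?_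
  rw [tendsto_iff_dist_tendsto_zero]
  refine squeeze_zero' (Eventually.of_forall fun _ => dist_nonneg) ?_
    tendsto_one_div_atTop_nhds_zero_nat
  filter_upwards [eventually_gt_atTop 0] with q hq
  have hq' : (0 : ℝ) < q := by exact_mod_cast hq
  rw [Real.dist_eq, div_sub' hq'.ne', abs_div, abs_of_pos hq']
  refine div_le_div_of_nonneg_right ?_ hq'.le
  rw [abs_le]
  exact ⟨by linarith [Int.lt_floor_add_one (q * y l)], by linarith [Int.floor_le (q * y l)]⟩

/-- Rational directions along which the given functionals nearly attain their norms. -/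
theorem exists_integer_directions (χ : Fin n → (Fin k → ℝ) →ₗ[ℝ] ℝ)
    (p : Seminorm ℝ (Fin k → ℝ)) {H : ℝ} (hH : H < ∑ i, dualNorm p (χ i)) :
    ∃ q : ℕ, 0 < q ∧ ∃ τ : Fin n → Fin k → ℤ, ∃ θ : ℝ, 0 < θ ∧ θ ≤ 1 ∧
      (∀ i, p (fun l => (τ i l : ℝ)) ≤ (1 - θ) * q) ∧
      q * H ≤ ∑ i, χ i (fun l => (τ i l : ℝ)) := by
  -- The `n` losses of `η` add up to less than the gap; the `+ 1` also covers `n = 0`.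
  set η : ℝ := (∑ i, dualNorm p (χ i) - H) / (n + 1) with hη
  have hη0 : 0 < η := div_pos (sub_pos.2 hH) (by positivity)
  have hex : ∀ i, ∃ y, p y < 1 ∧ dualNorm p (χ i) - η < χ i y := fun i =>
    exists_lt_apply_of_lt_dualNorm (by linarith)
  choose y hy1 hy2 using hex
  have hcont : ∀ i, Continuous (χ i) := fun i => (χ i).continuous_of_finiteDimensional
  have hev : ∀ᶠ q : ℕ in atTop, ∀ i, p (fun l => (⌊q * y i l⌋ : ℝ) / q) < 1 ∧
      dualNorm p (χ i) - η < χ i (fun l => (⌊q * y i l⌋ : ℝ) / q) := by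
    rw [eventually_all]
    intro i
    exact ((((continuous_seminorm p).tendsto _).comp (tendsto_floor_mul_div (y i))).eventually
      (gt_mem_nhds (hy1 i))).and ((((hcont i).tendsto _).comp
        (tendsto_floor_mul_div (y i))).eventually (lt_mem_nhds (hy2 i)))
  obtain ⟨q, hq, hq0⟩ := (hev.and (eventually_gt_atTop 0)).exists
  have hq' : (0 : ℝ) < q := by exact_mod_cast hq0
  have hscale : ∀ i, (fun l => (⌊q * y i l⌋ : ℝ) / q) =
      (q : ℝ)⁻¹ • (fun l => (⌊q * y i l⌋ : ℝ)) := fun i => by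
    ext l
    simp [div_eq_inv_mul]
  simp only [hscale, map_smul_eq_mul, map_smul, smul_eq_mul, norm_inv, Real.norm_natCast] at hq
  -- The finitely many strict inequalities `p < 1` leave a common margin `θ`.
  have hθ : ∀ᶠ θ : ℝ in nhdsWithin 0 (Set.Ioi 0), ∀ i,
      (q : ℝ)⁻¹ * p (fun l => (⌊q * y i l⌋ : ℝ)) < 1 - θ := by
    rw [eventually_all]
    intro i
    have h1 : Tendsto (fun θ : ℝ => 1 - θ) (nhdsWithin 0 (Set.Ioi 0)) (nhds 1) := by
      have : Continuous fun θ : ℝ => 1 - θ := by fun_prop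
      simpa using (this.tendsto 0).mono_left (nhdsWithin_le_nhds (s := Set.Ioi 0))
    exact h1.eventually (lt_mem_nhds (hq i).1)
  have hθ1 : ∀ᶠ θ : ℝ in nhdsWithin 0 (Set.Ioi 0), θ ≤ 1 :=
    nhdsWithin_le_nhds (ge_mem_nhds one_pos)
  have hθ0 : ∀ᶠ θ : ℝ in nhdsWithin 0 (Set.Ioi 0), 0 < θ := self_mem_nhdsWithin
  obtain ⟨θ, hθ, hθ1, hθ0⟩ := (hθ.and (hθ1.and hθ0)).exists
  refine ⟨q, hq0, fun i l => ⌊q * y i l⌋, θ, hθ0, hθ1, fun i => ?_, ?_⟩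
  · have := (hθ i).le
    rwa [inv_mul_le_iff₀ hq', mul_comm] at this
  · have h1 : ∀ i ∈ (Finset.univ : Finset (Fin n)), q * (dualNorm p (χ i) - η) ≤
        χ i (fun l => (⌊q * y i l⌋ : ℝ)) := by
      intro i _
      have := (hq i).2.le
      rwa [le_inv_mul_iff₀ hq'] at this
    refine le_trans ?_ (Finset.sum_le_sum h1)
    rw [← Finset.mul_sum, Finset.sum_sub_distrib]
    refine mul_le_mul_of_nonneg_left ?_ hq'.le
    have h2 : η * (n + 1) = ∑ i, dualNorm p (χ i) - H := by
      rw [hη]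
      field_simp
    simp only [Finset.sum_const, Finset.card_univ, Fintype.card_fin, nsmul_eq_mul]
    linarith

/-- For a suitable partition, Hamming balls of small radius are exponentially small. -/
theorem IsDiagonalization.exists_volume_hamming_ball_le (h : IsDiagonalization α Q lam χ)
    {p : Seminorm ℝ (Fin k → ℝ)} (hp : IsNorm p) {H : ℝ} (hH : H < ∑ i, dualNorm p (χ i)) :
    ∃ (N : ℕ) (ξ : Torus n → Fin N), Measurable ξ ∧ ∃ ε > 0, ∀ᶠ s : ℝ in atTop, ∀ x,
      volume {y | hamming α.act ξ (latticeBall p s) x y < ε} ≤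
        ENNReal.ofReal (Real.exp (-(s * H))) := by
  -- Directions are chosen with `3 * η` to spare, one `η` each for the number of bad times, the
  -- factor `exp (L * x * J)`, and the polynomial factors. The parameters are fixed in the order
  -- `x`, `β`, `ε`, since the cost of bad times involves $\log x^{-1}$.
  set η : ℝ := (∑ i, dualNorm p (χ i) - H) / 4 with hη
  have hη0 : 0 < η := by
    rw [hη]
    linarith
  obtain ⟨q, hq, τ, θ, hθ0, hθ1, hτ, hG⟩ := exists_integer_directions χ p
    (show H + 3 * η < ∑ i, dualNorm p (χ i) by rw [hη]; linarith)
  set G : ℝ := ∑ i, χ i (fun l => (τ i l : ℝ)) with hGdef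
  have hq1 : (1 : ℝ) ≤ q := by exact_mod_cast hq
  obtain ⟨r, hr, D, hD, L, hvol⟩ := h.volume_nearOrigin_le τ
  obtain ⟨N, ξ, hξm, hξ⟩ := exists_fine_partition (Torus n) hr
  obtain ⟨x, hx0, hx1, hxη⟩ : ∃ x : ℝ, 0 < x ∧ x ≤ 1 ∧ n * L * x ≤ η := by
    refine ⟨min 1 (η / (n * L + 1)), lt_min one_pos (by positivity), min_le_left _ _, ?_⟩
    calc (n : ℝ) * L * min 1 (η / (n * L + 1)) ≤ (n * L + 1) * (η / (n * L + 1)) := by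
          refine mul_le_mul (by linarith) (min_le_right _ _) ?_ (by positivity)
          exact le_min zero_le_one (by positivity)
      _ = η := by field_simp
  set ℓ : ℝ := Real.log x⁻¹ with hℓ
  have hℓ0 : 0 ≤ ℓ := Real.log_nonneg ((one_le_inv₀ hx0).2 hx1)
  obtain ⟨β, hβ0, hβη⟩ : ∃ β : ℝ, 0 < β ∧ 4 * n * ℓ * β ≤ η := by
    refine ⟨η / (4 * n * ℓ + 1), by positivity, ?_⟩
    rw [← mul_div_assoc, div_le_iff₀ (by positivity)]
    nlinarith
  obtain ⟨B, hB, hBF⟩ := hp.ncard_latticeBall_le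
  obtain ⟨b, hb, hbF⟩ := hp.le_ncard_latticeBall
  set C : ℝ := (B / (b * θ)) ^ k with hC
  have hC0 : 0 < C := by positivity
  obtain ⟨ε, hε0, hε⟩ : ∃ ε : ℝ, 0 < ε ∧ n * ε * C ≤ β := by
    refine ⟨β / (n * C + 1), by positivity, ?_⟩
    have : (n : ℝ) * (β / (n * C + 1)) * C = (n * C) * β / (n * C + 1) := by ring
    rw [this, div_le_iff₀ (by positivity)]
    nlinarith
  refine ⟨N, ξ, hξm, ε, hε0, ?_⟩
  have hpoly : ∀ᶠ s : ℝ in atTop, B ^ k * D * Real.exp |G| * s ^ k ≤ Real.exp (η * s) := by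
    have := ((isLittleO_pow_exp_pos_mul_atTop k hη0).const_mul_left
      (B ^ k * D * Real.exp |G|)).bound one_pos
    filter_upwards [this] with s hs
    rw [one_mul, Real.norm_of_nonneg (Real.exp_pos _).le] at hs
    exact (le_abs_self _).trans hs
  filter_upwards [hpoly, eventually_ge_atTop 1] with s hs hs1 y
  have hs0 : 0 < s := by linarith
  have hq0 : (0 : ℝ) < q := by linarith
  set J : ℕ := ⌊s / q⌋₊ with hJ
  have hJ1 : (J : ℝ) ≤ s / q := Nat.floor_le (by positivity)
  have hJ2 : s / q - 1 ≤ J := by linarith [Nat.lt_floor_add_one (s / q)]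
  have hJs : (J : ℝ) ≤ s := hJ1.trans (div_le_self hs0.le hq1)
  have hβF : n * ε * (latticeBall p s).ncard ≤ β * (latticeBall p (θ * s)).ncard := by
    have h1 : ((latticeBall p s).ncard : ℝ) ≤ C * (latticeBall p (θ * s)).ncard := by
      refine (hBF s hs1).trans (le_trans (le_of_eq ?_)
        (mul_le_mul_of_nonneg_left (hbF (θ * s) (by positivity)) hC0.le))
      rw [hC, ← mul_pow]
      congr 1
      field_simp
    calc n * ε * ((latticeBall p s).ncard : ℝ)
        ≤ n * ε * (C * (latticeBall p (θ * s)).ncard) :=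
          mul_le_mul_of_nonneg_left h1 (by positivity)
      _ = (n * ε * C) * (latticeBall p (θ * s)).ncard := by ring
      _ ≤ _ := mul_le_mul_of_nonneg_right hε (Nat.cast_nonneg _)
  refine (volume_hamming_ball_le α hp hθ0.le hθ1 hτ hξ hs0.le
    (by rwa [← le_div_iff₀ hq0]) hβF y).trans ?_
  set m : ℕ := ⌊β * (J + 1)⌋₊ with hm
  have hm1 : (m : ℝ) ≤ β * (2 * s) := by
    refine (Nat.floor_le (by positivity)).trans (mul_le_mul_of_nonneg_left ?_ hβ0.le)
    linarith
  refine (mul_le_mul_right (hvol x hx0 hx1 J m) _).trans ?_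
  rw [← ENNReal.ofReal_natCast, ← ENNReal.ofReal_mul (Nat.cast_nonneg _)]
  refine ENNReal.ofReal_le_ofReal ?_
  have hprod : ∏ i, (x⁻¹ ^ (2 * m) * Real.exp (L * x * J) *
      Real.exp (-χ i fun l => (τ i l : ℝ)) ^ J) =
      Real.exp (n * (2 * m * ℓ + L * x * J) - J * G) := by
    have hfac : ∀ i, x⁻¹ ^ (2 * m) * Real.exp (L * x * J) *
        Real.exp (-χ i fun l => (τ i l : ℝ)) ^ J =
        Real.exp ((2 * m * ℓ + L * x * J) - J * χ i fun l => (τ i l : ℝ)) := by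
      intro i
      have h1 : x⁻¹ ^ (2 * m) = Real.exp (2 * m * ℓ) := by
        have := Real.exp_nat_mul ℓ (2 * m)
        rw [hℓ, Real.exp_log (inv_pos.2 hx0)] at this
        rw [← this, hℓ]
        push_cast
        rfl
      rw [h1, ← Real.exp_nat_mul, ← Real.exp_add, ← Real.exp_add]
      congr 1
      ring
    simp only [hfac]
    rw [← Real.exp_sum, Finset.sum_sub_distrib, ← Finset.mul_sum]
    simp [hGdef, mul_add]
  rw [hprod]
  have hexp : (n : ℝ) * (2 * m * ℓ + L * x * J) - J * G ≤
      |G| + (2 * η * s - s * (H + 3 * η)) := by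
    have h1 : (n : ℝ) * (2 * m * ℓ) ≤ η * s := by
      calc (n : ℝ) * (2 * m * ℓ) = (2 * n * ℓ) * m := by ring
        _ ≤ (2 * n * ℓ) * (β * (2 * s)) := mul_le_mul_of_nonneg_left hm1 (by positivity)
        _ = (4 * n * ℓ * β) * s := by ring
        _ ≤ η * s := mul_le_mul_of_nonneg_right hβη hs0.le
    have h2 : (n : ℝ) * (L * x * J) ≤ η * s := by
      calc (n : ℝ) * (L * x * J) = (n * L * x) * J := by ring
        _ ≤ η * s := mul_le_mul hxη hJs (Nat.cast_nonneg _) hη0.le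
    -- Rounding `s / q` down to `J` costs a bounded factor, whatever the sign of `G`.
    have h3 : (s / q - J) * G ≤ |G| := by
      refine (le_abs_self _).trans ?_
      rw [abs_mul]
      refine mul_le_of_le_one_left (abs_nonneg _) ?_
      rw [abs_le]
      constructor <;> linarith
    have h4 : s * (H + 3 * η) ≤ s / q * G := by
      have := mul_le_mul_of_nonneg_left hG (show 0 ≤ s / q by positivity)
      refine le_trans (le_of_eq ?_) this
      field_simp
    linarith
  calc ((latticeBall p s).ncard : ℝ) *
        (D * Real.exp (n * (2 * m * ℓ + L * x * J) - J * G))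
      ≤ (B * s) ^ k * (D * Real.exp (|G| + (2 * η * s - s * (H + 3 * η)))) := by
        refine mul_le_mul (hBF s hs1) ?_ (by positivity) (by positivity)
        exact mul_le_mul_of_nonneg_left (Real.exp_le_exp.2 hexp) hD.le
    _ = (B ^ k * D * Real.exp |G| * s ^ k) * Real.exp (2 * η * s - s * (H + 3 * η)) := by
        rw [Real.exp_add, mul_pow]
        ring
    _ ≤ Real.exp (η * s) * Real.exp (2 * η * s - s * (H + 3 * η)) :=
        mul_le_mul_of_nonneg_right hs (Real.exp_pos _).le
    _ = Real.exp (-(s * H)) := by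
        rw [← Real.exp_add]
        congr 1
        ring

/-- With `δ = 1 / 2`, covering half of the space by sets of measure at most $e^{-sH}$ takes at least
$e^{sH}/2$ of them. -/
theorem IsDiagonalization.le_slowEntropyNorm (h : IsDiagonalization α Q lam χ)
    {p : Seminorm ℝ (Fin k → ℝ)} (hp : IsNorm p) :
    ((∑ i, dualNorm p (χ i) : ℝ) : EReal) ≤
      slowEntropyNorm (volume : Measure (Torus n)) α.act p := by
  refine EReal.ge_of_forall_gt_iff_ge.1 fun H hH => ?_
  obtain ⟨N, ξ, hξ, ε, hε, hvol⟩ := h.exists_volume_hamming_ball_le hp (EReal.coe_lt_coe_iff.1 hH)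
  refine le_iSup_of_le N (le_iSup₂_of_le ξ hξ (le_iSup₂_of_le ε hε
    (le_iSup₂_of_le (1 / 2 : ℝ) one_half_pos ?_)))
  have hlim : Tendsto (fun s : ℝ => ((H - Real.log 2 / s : ℝ) : EReal)) atTop
      (nhds (H : EReal)) := by
    refine (continuous_coe_real_ereal.tendsto H).comp ?_
    simpa using (tendsto_const_nhds.div_atTop tendsto_id : Tendsto (fun s : ℝ => Real.log 2 / s)
      atTop (nhds 0)).const_sub H
  rw [← hlim.limsup_eq]
  refine limsup_le_limsup ?_
  filter_upwards [hvol, eventually_gt_atTop 0] with s hs hs0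
  obtain ⟨F, hF⟩ := (hp.finite_latticeBall s).exists_finset_coe
  rw [← hF] at hs ⊢
  obtain ⟨E, hE, hcov⟩ := exists_card_eq_coverNumber (volume : Measure (Torus n)) α.act ξ F hε
    (one_half_pos (α := ℝ)).le
  rw [← hE, EReal.coe_le_coe_iff, le_div_iff₀ hs0, sub_mul, div_mul_cancel₀ _ hs0.ne']
  have h1 : ENNReal.ofReal (1 - 1 / 2) ≤ ENNReal.ofReal (E.card * Real.exp (-(s * H))) := by
    refine hcov.trans ((measure_biUnion_finset_le _ _).trans ?_)
    refine (Finset.sum_le_sum fun x _ => hs x).trans ?_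
    rw [Finset.sum_const, nsmul_eq_mul, ENNReal.ofReal_mul (Nat.cast_nonneg _),
      ENNReal.ofReal_natCast]
  rw [ENNReal.ofReal_le_ofReal_iff (by positivity)] at h1
  have h2 : Real.exp (s * H) / 2 ≤ E.card := by
    have h3 := mul_le_mul_of_nonneg_right h1 (Real.exp_pos (s * H)).le
    rw [mul_assoc, ← Real.exp_add, neg_add_cancel, Real.exp_zero, mul_one] at h3
    linarith
  have h4 := Real.log_le_log (by positivity) h2
  rw [Real.log_div (Real.exp_pos _).ne' two_ne_zero, Real.log_exp] at h4
  linarith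

/-- The slow entropy of a diagonalizable action with respect to a norm is the sum of the dual
norms of its Lyapunov exponents. -/
theorem IsDiagonalization.slowEntropyNorm_eq (h : IsDiagonalization α Q lam χ)
    {p : Seminorm ℝ (Fin k → ℝ)} (hp : IsNorm p) :
    slowEntropyNorm (volume : Measure (Torus n)) α.act p =
      ((∑ i, dualNorm p (χ i) : ℝ) : EReal) :=
  le_antisymm (h.slowEntropyNorm_le hp) (h.le_slowEntropyNorm hp)

end LowerBound

/-- The slow entropy of a Cartan action in terms of its associated field. -/
theorem IsAssociatedField.slowEntropy_eq {k : ℕ} (hk : 0 < k) {α : AffineAction k (k + 1)}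
    (hα : ∀ t, t ≠ 0 → IsHyperbolic (α.mat t)) {K : Type*} [Field K] [NumberField K]
    {γ : Multiplicative (Fin k → ℤ) →* (NumberField.RingOfIntegers K)ˣ}
    (h : IsAssociatedField α K γ) :
    slowEntropy (volume : Measure (Torus (k + 1))) α.act =
      ((modelConst k * ((unitGroup γ).index * NumberField.Units.regulator K) ^ (1 / (k : ℝ)) : ℝ) :
        EReal) := by
  obtain ⟨Q, lam, χ, L, hQ, hmul, habs, hL, h0, hs⟩ := h.exists_diagonalization hα
  have hd : IsDiagonalization α Q lam χ := ⟨hQ, hmul, habs⟩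
  have hR : (0 : ℝ) < (unitGroup γ).index * NumberField.Units.regulator K :=
    mul_pos (Nat.cast_pos.2 (Nat.pos_of_ne_zero (h.finiteIndex hα).index_ne_zero))
      (NumberField.Units.regulator_pos K)
  rw [← iInf_sum_dualNorm hk χ L hR hL h0 hs]
  exact iInf_congr fun p => iInf_congr fun hp => iInf_congr fun _ => hd.slowEntropyNorm_eq hp

end SlowEntropy

theorem theorem4p6 :
    ∃ C : ℕ → ℝ, ∀ n : ℕ, 2 ≤ n →
      (((n : ℝ) - 1) / 2 ≤ C n ∧ C n ≤ (n : ℝ) - 1) ∧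
      ∀ α : SlowEntropy.AffineAction (n - 1) n, SlowEntropy.IsCartan α →
        (∃ (K : Type) (_ : Field K) (_ : NumberField K)
          (γ : Multiplicative (Fin (n - 1) → ℤ) →* (NumberField.RingOfIntegers K)ˣ),
          SlowEntropy.IsAssociatedField α K γ) ∧
        ∀ (K : Type*) [Field K] [NumberField K]
          (γ : Multiplicative (Fin (n - 1) → ℤ) →* (NumberField.RingOfIntegers K)ˣ),
          SlowEntropy.IsAssociatedField α K γ →
            NumberField.IsTotallyReal K ∧
            (SlowEntropy.unitGroup γ).FiniteIndex ∧
            SlowEntropy.slowEntropy (MeasureTheory.volume : MeasureTheory.Measure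
                (SlowEntropy.Torus n)) α.act =
              ((C n * (((SlowEntropy.unitGroup γ).index : ℝ) *
                NumberField.Units.regulator K) ^ (1 / ((n : ℝ) - 1)) : ℝ) : EReal) := by
  refine ⟨fun n => SlowEntropy.modelConst (n - 1), fun n hn => ?_⟩
  obtain ⟨k, rfl⟩ : ∃ k, n = k + 1 := ⟨n - 1, by omega⟩
  have hk : ((k + 1 : ℕ) : ℝ) - 1 = k := by
    push_cast
    ring
  rw [hk]
  refine ⟨⟨SlowEntropy.le_modelConst k, SlowEntropy.modelConst_le k⟩, fun α hα => ?_⟩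
  refine ⟨SlowEntropy.exists_isAssociatedField (Nat.succ_pos k) α, fun K _ _ γ h => ?_⟩
  -- Restated over `k`, to which `k + 1 - 1` reduces by definition.
  have h' : SlowEntropy.IsAssociatedField (k := k) (n := k + 1) α K γ := h
  exact ⟨h'.isTotallyReal hα, h'.finiteIndex hα, h'.slowEntropy_eq (by omega) hα⟩
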